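/- Let $k$ be a field of characteristic zero, let $s \ge r \ge 3$ and $n, m \ge 0$ be integers, let $S = k[x_1,\dots,x_s]$, and let $S_d$ denote the space of forms of degree $d$ in $S$. Order monomials of the same degree by the reverse lexicographic order: $x^I > x^J$ if $i_t < j_t$, where $t$ is the greatest index with $i_t \neq j_t$. For a form $f \ne 0$ let its initial monomial be the largest monomial occurring in $f$. Let $K_G = k(u_{ij} : 1 \le i,j \le s)$ be the function field of $G = GL_s$ over $k$, let $U = (u_{ij})$ be the generic matrix, and let $\gamma : S \to K_G[x_1,\dots,x_s]$ be the $k$-algebra homomorphism with $\gamma(x_i) = \sum_{j} (U^{-1})_{ij}\, x_j$ (the generic change of coordinates). For a linear subspace $V \subseteq S_d$ let the generic initial space $\operatorname{gin} V \subseteq S_d$ be the $k$-span of the initial monomials of the nonzero forms in the $K_G$-linear span of $\gamma(V)$. Let $W = (x_1,\dots,x_r) \subseteq S_1$ be the linear space spanned by $x_1,\dots,x_r$, and let $W^n \subseteq S_n$ be its $n$-th power, i.e. the span of all products of $n$ elements of $W$ (with $W^0 = k$). **Theorem.** Let $V \subseteq S_{n+m}$ be a linear subspace such that $$\operatorname{gin}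 V = W^n x_1^m .$$ Then there exist a form $p \in S_m$ and a linear subspace $W_n \subseteq S_n$ such that $V = W_n\, p = \{wp : w \in W_n\}$. Moreover, if $s = r$, then one can take $W_n = S_n$, that is, $V = S_n\, p$. -/

import Mathlib

open scoped BigOperators

noncomputable section

/-- The (strict) reverse lexicographic order on exponents of monomials of the same degree:
`x^J < x^I` iff at the last index `t` at which the exponents differ one has `I t < J t`. -/
def RevLexLT {s : ℕ} (J I : Fin s →₀ ℕ) : Prop :=
  ∃ t : Fin s, I t < J t ∧ ∀ j : Fin s, t < j → I j = J j

/-- `x^I` is the initial monomial of `f` for the revlex order: it occurs in `f`, and every other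
monomial occurring in `f` is smaller. -/
def IsInitialExponent {s : ℕ} {K : Type*} [Field K] (f : MvPolynomial (Fin s) K)
    (I : Fin s →₀ ℕ) : Prop :=
  I ∈ f.support ∧ ∀ J ∈ f.support, J ≠ I → RevLexLT J I

/-- The exponents of the initial monomials of the forms (homogeneous polynomials) in `V`.
The form `0` has no initial monomial. -/
def initialExponents {s : ℕ} {K : Type*} [Field K] (V : Submodule K (MvPolynomial (Fin s) K)) :
    Set (Fin s →₀ ℕ) :=
  {I | ∃ f ∈ V, (∃ d : ℕ, f.IsHomogeneous d) ∧ IsInitialExponent f I}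

/-- The function field `K_G` of `G = GL_s` over `k`: since `GL_s` is a nonempty open subset of the
affine space of `s × s` matrices, it is the field of rational functions in the coordinates
`u_{ij}`. -/
abbrev GenericField (k : Type*) [Field k] (s : ℕ) : Type _ :=
  FractionRing (MvPolynomial (Fin s × Fin s) k)

/-- The generic matrix `(u_{ij})`, with entries in the function field of `GL_s`. -/
def genericMatrix (k : Type*) [Field k] (s : ℕ) : Matrix (Fin s) (Fin s) (GenericField k s) :=
  (Matrix.mvPolynomialX (Fin s) (Fin s) k).map
    (algebraMap (MvPolynomial (Fin s × Fin s) k) (GenericField k s))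

/-- The generic change of coordinates `γ : k[x] → K_G[x]`, i.e. the action of the generic point `g`
of `GL_s`, `(γ f)(a) = f (g⁻¹ a)`; thus `γ x_i = ∑ j, (g⁻¹)_{ij} x_j`. -/
def genericCoordChange (k : Type*) [Field k] (s : ℕ) :
    MvPolynomial (Fin s) k →ₐ[k] MvPolynomial (Fin s) (GenericField k s) :=
  MvPolynomial.aeval fun i : Fin s =>
    ∑ j : Fin s, MvPolynomial.C ((genericMatrix k s)⁻¹ i j) * MvPolynomial.X j

/-- The generic initial space `gin V` over `k` of a (homogeneous) linear subspace `V` of `k[x]`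
for the revlex order: the `k`-span of the initial monomials of the forms in the `K_G`-subspace of
`K_G[x]` generated by `γ(V)`. -/
def gin {k : Type*} [Field k] {s : ℕ} (V : Submodule k (MvPolynomial (Fin s) k)) :
    Submodule k (MvPolynomial (Fin s) k) :=
  Submodule.span k ((fun I : Fin s →₀ ℕ => MvPolynomial.monomial I (1 : k)) ''
    initialExponents (Submodule.span (GenericField k s)
      (genericCoordChange k s '' (V : Set (MvPolynomial (Fin s) k)))))

/-- The space `W = (x_1, …, x_r)` of linear forms spanned by the first `r` variables. -/
def firstVars (k : Type*) [Field k] (s r : ℕ) : Submodule k (MvPolynomial (Fin s) k) :=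
  Submodule.span k {f | ∃ i : Fin s, (i : ℕ) < r ∧ f = MvPolynomial.X i}

/-- The space `A · p = {a * p | a ∈ A}`. -/
def mulForm {k : Type*} [Field k] {s : ℕ} (A : Submodule k (MvPolynomial (Fin s) k))
    (p : MvPolynomial (Fin s) k) : Submodule k (MvPolynomial (Fin s) k) :=
  A.map (LinearMap.mulRight k p)

end

/-! Inversion on `GL_s` induces an endomorphism of `K_G` exchanging `U` and `U⁻¹`, so initial
monomials may be computed after substituting with `U` itself, whose entries are independent
variables. Setting all but the first three variables to zero restricts forms to a generic plane. For
revlex this only discards smaller monomials, so the `K_G`-span V' of the restrictions has initial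
monomials `X₀^m` times a monomial of degree n, among them `X₀^m X₂^n`. The latter yields a form p of
degree m with `X₂^n p` in V'.

Moving the flag infinitesimally is the engine. The vector field `X_b ↦ X_a`, combined with the
derivation of `K_G` sending column a of `U` to minus column b, kills every restricted form with
coefficients in k; hence V' is stable under D (`X₂ ↦ X₁`) and D' (`X₁ ↦ X₀`). Leading terms of V'
have `X₀`-degree at least m, and this forces D' p = c p (`derivation'_p`) and, by approximation
modulo powers of `X₂`, D p = a p (`derivation_p`). Applying D - a and D' - c repeatedly to `X₂^n p`
puts every `X₂^N X₀^t X₁^j p` of degree n + m into V', and division with remainder on the line `X₂ =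
0` then shows that p divides V' (`dvd_of_mem`).

It remains to descend from the plane. Let g be a common divisor of V of maximal degree. Two of its
cofactors are relatively prime and stay so on the generic plane (`isRelPrime_planeRestriction`), so
p divides the restriction of g. Conversely that restriction divides `X₂^n p` and `X₁^n p`, hence p.
Thus g has degree m and V = W g for the space W of cofactors. If s = r, independence of polynomials
with distinct initial monomials gives dim V ≥ dim S_n, so W = S_n. -/

/-! ### Factors of homogeneous polynomials -/

/-- The coefficients of the image of `f` under `X i ↦ X i * T` are the homogeneous components. -/
theorem coeff_aeval_C_X_mul_X {σ R : Type*} [CommRing R] (f : MvPolynomial σ R) (n : ℕ) :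
    (MvPolynomial.aeval (fun i => Polynomial.C (MvPolynomial.X i) * Polynomial.X :
      σ → Polynomial (MvPolynomial σ R)) f).coeff n = MvPolynomial.homogeneousComponent n f := by
  classical
  induction f using MvPolynomial.induction_on' with
  | monomial u a =>
    have h : MvPolynomial.aeval (fun i => Polynomial.C (MvPolynomial.X i) * Polynomial.X :
        σ → Polynomial (MvPolynomial σ R)) (MvPolynomial.monomial u a) =
        Polynomial.C (MvPolynomial.monomial u a) * Polynomial.X ^ u.degree := by
      rw [MvPolynomial.aeval_monomial, MvPolynomial.monomial_eq, Finsupp.degree]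
      simp only [mul_pow, Finsupp.prod, Finset.prod_mul_distrib, map_mul, map_prod, map_pow,
        Finset.prod_pow_eq_pow_sum]
      rw [mul_assoc]
      rfl
    rw [h, Polynomial.coeff_C_mul, Polynomial.coeff_X_pow]
    have hm := MvPolynomial.isHomogeneous_monomial (σ := σ) (d := u) a (rfl : u.degree = u.degree)
    rw [MvPolynomial.homogeneousComponent_of_mem hm]
    split_ifs <;> simp_all
  | add p q hp hq => rw [map_add, Polynomial.coeff_add, hp, hq, map_add]

/-- A factor of a nonzero homogeneous polynomial over a domain is homogeneous. -/
theorem MvPolynomial.IsHomogeneous.exists_of_mul_ne_zero {σ R : Type*} [CommRing R] [IsDomain R]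
    {a b : MvPolynomial σ R} {d : ℕ} (h : (a * b).IsHomogeneous d) (h0 : a * b ≠ 0) :
    ∃ e, a.IsHomogeneous e := by
  classical
  set Φ := MvPolynomial.aeval (R := R) (fun i => Polynomial.C (MvPolynomial.X i) * Polynomial.X :
      σ → Polynomial (MvPolynomial σ R)) with hΦ
  have hmon : Φ (a * b) = Polynomial.C (a * b) * Polynomial.X ^ d := by
    ext1 n
    rw [coeff_aeval_C_X_mul_X, Polynomial.coeff_C_mul, Polynomial.coeff_X_pow,
      MvPolynomial.homogeneousComponent_of_mem h]
    split_ifs <;> simp_all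
  have hne : Φ (a * b) ≠ 0 := by
    rw [hmon]
    exact mul_ne_zero (by simpa using h0) (pow_ne_zero _ Polynomial.X_ne_zero)
  have ha0 : Φ a ≠ 0 := fun h => hne (by rw [map_mul, h, zero_mul])
  have hb0 : Φ b ≠ 0 := fun h => hne (by rw [map_mul, h, mul_zero])
  have h1 : (Φ a).natDegree + (Φ b).natDegree = d := by
    rw [← Polynomial.natDegree_mul ha0 hb0, ← map_mul, hmon,
      Polynomial.natDegree_C_mul_X_pow _ _ h0]
  have h2 : (Φ a).natTrailingDegree + (Φ b).natTrailingDegree = d := by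
    rw [← Polynomial.natTrailingDegree_mul ha0 hb0, ← map_mul, hmon,
      Polynomial.C_mul_X_pow_eq_monomial, Polynomial.natTrailingDegree_monomial h0]
  -- Degree and order are both additive and both equal d on the product, so they agree on each
  -- factor: `Φ a` has a single nonzero coefficient.
  have h3 := Polynomial.natTrailingDegree_le_natDegree (Φ a)
  have h4 := Polynomial.natTrailingDegree_le_natDegree (Φ b)
  obtain ⟨e, he⟩ : ∃ e, e = (Φ a).natDegree := ⟨_, rfl⟩
  refine ⟨e, ?_⟩
  rw [← MvPolynomial.sum_homogeneousComponent a]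
  refine MvPolynomial.IsHomogeneous.sum _ _ _ fun i _ => ?_
  by_cases hi : i = e
  · rw [← hi]; exact MvPolynomial.homogeneousComponent_isHomogeneous i a
  · have : MvPolynomial.homogeneousComponent i a = 0 := by
      rw [← coeff_aeval_C_X_mul_X]
      rcases lt_or_gt_of_ne hi with hi | hi
      · exact Polynomial.coeff_eq_zero_of_lt_natTrailingDegree (by rw [← hΦ]; omega)
      · exact Polynomial.coeff_eq_zero_of_natDegree_lt (he ▸ hi)
    rw [this]; exact MvPolynomial.isHomogeneous_zero _ _ _

/-- Cancellation of a homogeneous factor preserves homogeneity. -/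
theorem MvPolynomial.IsHomogeneous.of_mul_left {σ R : Type*} [CommRing R] [IsDomain R]
    {a b : MvPolynomial σ R} {d i : ℕ} (ha : a.IsHomogeneous i) (ha0 : a ≠ 0)
    (h : (a * b).IsHomogeneous d) (hb0 : b ≠ 0) : ∃ j, i + j = d ∧ b.IsHomogeneous j := by
  obtain ⟨e, he⟩ := MvPolynomial.IsHomogeneous.exists_of_mul_ne_zero
    (by rwa [mul_comm] at h : (b * a).IsHomogeneous d) (mul_ne_zero hb0 ha0)
  exact ⟨e, (ha.mul he).inj_right h (mul_ne_zero ha0 hb0), he⟩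

/-! ### Restriction of ternary forms to a line -/

/-- Specialization `(X₀, X₁, X₂) ↦ (X, 1, 0)` of ternary forms, i.e. restriction to the line
`X₂ = 0` followed by dehomogenization. -/
noncomputable def restrictLine (K : Type*) [Field K] :
    MvPolynomial (Fin 3) K →ₐ[K] Polynomial K :=
  MvPolynomial.aeval ![Polynomial.X, 1, 0]

section restrictLine

variable {K : Type*} [Field K]

@[simp] theorem restrictLine_X0 : restrictLine K (MvPolynomial.X 0) = Polynomial.X := by
  simp [restrictLine]

@[simp] theorem restrictLine_X1 : restrictLine K (MvPolynomial.X 1) = 1 := by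
  simp [restrictLine]

@[simp] theorem restrictLine_X2 : restrictLine K (MvPolynomial.X 2) = 0 := by
  simp [restrictLine]

@[simp] theorem restrictLine_C (a : K) :
    restrictLine K (MvPolynomial.C a) = Polynomial.C a := by
  simp [restrictLine]

theorem restrictLine_monomial (I : Fin 3 →₀ ℕ) (a : K) :
    restrictLine K (MvPolynomial.monomial I a) =
      if I 2 = 0 then Polynomial.monomial (I 0) a else 0 := by
  rw [restrictLine, MvPolynomial.aeval_monomial, Finsupp.prod_fintype _ _ (by simp),
    Fin.prod_univ_three]
  simp only [Matrix.cons_val_zero, Matrix.cons_val_one, Matrix.cons_val, one_pow, mul_one]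
  split_ifs with h
  · simp [h, Polynomial.C_mul_X_pow_eq_monomial]
  · simp [h]

/-- Nothing cancels: for fixed degree and `X₂`-exponent zero, the `X₀`-exponent determines the
monomial. -/
theorem coeff_restrictLine {f : MvPolynomial (Fin 3) K} {d : ℕ} (hf : f.IsHomogeneous d)
    {I : Fin 3 →₀ ℕ} (hI : I.degree = d) (hI2 : I 2 = 0) :
    (restrictLine K f).coeff (I 0) = f.coeff I := by
  conv_lhs => rw [f.as_sum]
  rw [map_sum, Polynomial.finsetSum_coeff]
  rw [Finset.sum_eq_single I]
  · rw [restrictLine_monomial, if_pos hI2, Polynomial.coeff_monomial, if_pos rfl]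
  · intro J hJ hJI
    rw [restrictLine_monomial]
    split_ifs with h2
    · rw [Polynomial.coeff_monomial, if_neg]
      intro h0
      apply hJI
      have hJd : J.degree = d := by
        rw [Finsupp.degree_eq_weight_one]
        exact hf (MvPolynomial.mem_support_iff.mp hJ)
      rw [Finsupp.degree_eq_sum, Fin.sum_univ_three] at hJd hI
      ext i
      fin_cases i
      · exact h0
      · change J 1 = I 1
        omega
      · exact h2.trans hI2.symm
    · simp
  · intro h
    rw [restrictLine_monomial, if_pos hI2, MvPolynomial.notMem_support_iff.mp h]
    simp

theorem natDegree_restrictLine_le {f : MvPolynomial (Fin 3) K} {d : ℕ} (hf : f.IsHomogeneous d) :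
    (restrictLine K f).natDegree ≤ d := by
  conv_lhs => rw [f.as_sum]
  rw [map_sum]
  refine Polynomial.natDegree_sum_le_of_forall_le _ _ fun J hJ => ?_
  rw [restrictLine_monomial]
  split_ifs with h2
  · refine (Polynomial.natDegree_monomial_le _).trans ?_
    have hJd : J.degree = d := by
      rw [Finsupp.degree_eq_weight_one]
      exact hf (MvPolynomial.mem_support_iff.mp hJ)
    rw [Finsupp.degree_eq_sum, Fin.sum_univ_three] at hJd
    omega
  · simp

theorem X2_dvd_of_restrictLine_eq_zero {f : MvPolynomial (Fin 3) K} {d : ℕ}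
    (hf : f.IsHomogeneous d) (h0 : restrictLine K f = 0) : MvPolynomial.X 2 ∣ f := by
  rw [MvPolynomial.X_dvd_iff_modMonomial_eq_zero]
  ext I
  rw [MvPolynomial.coeff_zero]
  by_cases hI : I 2 = 0
  · rw [MvPolynomial.coeff_modMonomial_of_not_le _ (by
      intro h
      have := h 2
      simp [hI] at this)]
    by_cases hd : I.degree = d
    · rw [← coeff_restrictLine hf hd hI, h0, Polynomial.coeff_zero]
    · exact hf.coeff_eq_zero hd
  · refine MvPolynomial.coeff_modMonomial_of_le _ ?_
    intro i
    rw [Finsupp.single_apply]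
    split_ifs with h
    · subst h; omega
    · omega

end restrictLine

/-! ### Ternary forms stable under infinitesimal changes of flag -/

/-- A space `V` of ternary forms of degree `n + m`, stable under derivations acting on the
coordinates by `X₂ ↦ X₁ ↦ 0` and `X₁ ↦ X₀ ↦ 0` respectively, whose revlex initial monomials are
of the form `X₀^m` times a monomial of degree `n`, with `X₀^m X₂^n` among them. -/
structure IsFlagStable {k K : Type*} [Field k] [Field K] [Algebra k K]
    (V : Submodule K (MvPolynomial (Fin 3) K)) (n m : ℕ)
    (D D' : Derivation k (MvPolynomial (Fin 3) K) (MvPolynomial (Fin 3) K))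
    (p : MvPolynomial (Fin 3) K) : Prop where
  homogeneous : ∀ f ∈ V, f.IsHomogeneous (n + m)
  stable : ∀ f ∈ V, D f ∈ V
  stable' : ∀ f ∈ V, D' f ∈ V
  map_X1 : D (MvPolynomial.X 1) = 0
  map_X2 : D (MvPolynomial.X 2) = MvPolynomial.X 1
  map_X0' : D' (MvPolynomial.X 0) = 0
  map_X1' : D' (MvPolynomial.X 1) = MvPolynomial.X 0
  map_X2' : D' (MvPolynomial.X 2) = 0
  lead : ∀ N g, MvPolynomial.X 2 ^ N * g ∈ V → restrictLine K g ≠ 0 →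
    N ≤ n ∧ m ≤ (restrictLine K g).natDegree
  homogeneous_p : p.IsHomogeneous m
  mem_p : MvPolynomial.X 2 ^ n * p ∈ V
  natDegree_p : (restrictLine K p).natDegree = m
  p_ne : restrictLine K p ≠ 0

namespace IsFlagStable

open MvPolynomial

variable {k K : Type*} [Field k] [Field K] [Algebra k K]
  {V : Submodule K (MvPolynomial (Fin 3) K)} {n m : ℕ}
  {D D' : Derivation k (MvPolynomial (Fin 3) K) (MvPolynomial (Fin 3) K)}
  {p : MvPolynomial (Fin 3) K}

theorem C_mul_mem {V : Submodule K (MvPolynomial (Fin 3) K)} {f : MvPolynomial (Fin 3) K} (a : K)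
    (hf : f ∈ V) : C a * f ∈ V := by
  rw [← smul_eq_C_mul]; exact V.smul_mem a hf

theorem mem_of_C_mul_mem {V : Submodule K (MvPolynomial (Fin 3) K)} {f : MvPolynomial (Fin 3) K}
    {a : K} (ha : a ≠ 0) (hf : C a * f ∈ V) : f ∈ V := by
  have := C_mul_mem a⁻¹ hf
  rwa [← mul_assoc, ← C_mul, inv_mul_cancel₀ ha, C_1, one_mul] at this

theorem homogeneous_right (h : IsFlagStable V n m D D' p) {N : ℕ} {g : MvPolynomial (Fin 3) K}
    (hg : X 2 ^ N * g ∈ V) (h0 : g ≠ 0) : ∃ e, N + e = n + m ∧ g.IsHomogeneous e :=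
  MvPolynomial.IsHomogeneous.of_mul_left (isHomogeneous_X_pow 2 N) (pow_ne_zero _ (X_ne_zero _))
    (h.homogeneous _ hg) h0

theorem X2_dvd (h : IsFlagStable V n m D D' p) {N : ℕ} {g : MvPolynomial (Fin 3) K}
    (hg : X 2 ^ N * g ∈ V) (h0 : restrictLine K g = 0) : X 2 ∣ g := by
  by_cases hg0 : g = 0
  · rw [hg0]; exact dvd_zero _
  · obtain ⟨e, -, he⟩ := h.homogeneous_right hg hg0
    exact X2_dvd_of_restrictLine_eq_zero he h0

/-- Once all powers of `X₂` are extracted, the cofactor is nonzero on the line, and `lead` bounds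
the total power by n. -/
theorem eq_zero_of_lt (h : IsFlagStable V n m D D' p) {N : ℕ} {g : MvPolynomial (Fin 3) K}
    (hg : X 2 ^ N * g ∈ V) (hN : n < N) : g = 0 := by
  by_contra h0
  have hfin : FiniteMultiplicity (X 2 : MvPolynomial (Fin 3) K) g :=
    FiniteMultiplicity.of_prime_left (X_prime) h0
  obtain ⟨M, c, hc⟩ : ∃ M c, g = X 2 ^ M * c ∧ ¬ X 2 ∣ c := by
    obtain ⟨c, hc, hc'⟩ := hfin.exists_eq_pow_mul_and_not_dvd
    exact ⟨_, c, hc, hc'⟩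
  have hmem : X 2 ^ (N + M) * c ∈ V := by
    rw [pow_add, mul_assoc, ← hc.1]; exact hg
  have := (h.lead _ _ hmem fun h0 => hc.2 (h.X2_dvd hmem h0)).1
  omega

/-- This uniqueness of p turns stability under derivations into eigenvector equations. A suitable
multiple of p cancels the `X₀^m` term of q; by `lead` the difference then vanishes on the line, so
it is divisible by `X₂`, and `eq_zero_of_lt` kills it. -/
theorem exists_eq_C_mul (h : IsFlagStable V n m D D' p) {q : MvPolynomial (Fin 3) K}
    (hq : X 2 ^ n * q ∈ V) : ∃ c : K, q = C c * p := by
  set P := restrictLine K p with hP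
  set a := (restrictLine K q).coeff m / P.leadingCoeff with ha
  have hmem : X 2 ^ n * (q - C a * p) ∈ V := by
    have : X 2 ^ n * (q - C a * p) = X 2 ^ n * q - C a * (X 2 ^ n * p) := by ring
    rw [this]; exact V.sub_mem hq (C_mul_mem a h.mem_p)
  refine ⟨a, ?_⟩
  have hres : restrictLine K (q - C a * p) = 0 := by
    by_contra hne
    have h1 := (h.lead _ _ hmem hne).2
    have hne' : q - C a * p ≠ 0 := fun h => hne (by rw [h, map_zero])
    obtain ⟨e, he, hhom⟩ := h.homogeneous_right hmem hne'
    have h2 := natDegree_restrictLine_le hhom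
    have h3 : (restrictLine K (q - C a * p)).natDegree = m := by omega
    apply hne
    rw [← Polynomial.leadingCoeff_eq_zero, Polynomial.leadingCoeff, h3, map_sub, map_mul,
      restrictLine_C, Polynomial.coeff_sub, Polynomial.coeff_C_mul, ← hP, ha]
    have : P.coeff m = P.leadingCoeff := by rw [Polynomial.leadingCoeff, h.natDegree_p]
    rw [this, div_mul_cancel₀ _ (Polynomial.leadingCoeff_ne_zero.mpr h.p_ne), sub_self]
  obtain ⟨g, hg⟩ := h.X2_dvd hmem hres
  have : g = 0 := h.eq_zero_of_lt (N := n + 1) (by rwa [pow_succ, mul_assoc, ← hg]) (by omega)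
  rw [this, mul_zero] at hg
  exact sub_eq_zero.mp hg

theorem derivation_pow_X2 (h : IsFlagStable V n m D D' p) (N : ℕ) :
    D (X 2 ^ N) = (N : MvPolynomial (Fin 3) K) * X 2 ^ (N - 1) * X 1 := by
  rw [Derivation.leibniz_pow, h.map_X2]
  simp [mul_assoc]

theorem derivation'_mul (h : IsFlagStable V n m D D' p) (N t j : ℕ) (f : MvPolynomial (Fin 3) K) :
    D' (X 2 ^ N * (X 0 ^ t * X 1 ^ j * f)) =
      X 2 ^ N * (X 0 ^ t * ((j : MvPolynomial (Fin 3) K) * X 1 ^ (j - 1) * X 0 * f +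
        X 1 ^ j * D' f)) := by
  simp only [Derivation.leibniz, Derivation.leibniz_pow, h.map_X0', h.map_X1', h.map_X2',
    smul_eq_mul, nsmul_eq_mul]
  ring

/-- D' kills `X₂`, so it passes through `X₂^n` and `X₂^n * D' p` lies in V. -/
theorem derivation'_p (h : IsFlagStable V n m D D' p) : ∃ c : K, D' p = C c * p := by
  apply h.exists_eq_C_mul
  have := h.stable' _ h.mem_p
  have h2 := h.derivation'_mul n 0 0 p
  simp only [pow_zero, one_mul, Nat.cast_zero, zero_mul, zero_add] at h2
  rwa [h2] at this

/-- Each application of D trades one factor `X₂` for `X₁`; the term where D hits the cofactor keeps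
its power of `X₂` and is absorbed in the error. -/
theorem exists_mem_X1_pow [CharZero K] (h : IsFlagStable V n m D D' p) (j : ℕ) :
    ∀ N, j + N = n →
    ∃ g, X 2 ^ N * (X 1 ^ j * p + X 2 * g) ∈ V := by
  induction j with
  | zero =>
    intro N hN
    obtain rfl : N = n := by omega
    exact ⟨0, by simpa using h.mem_p⟩
  | succ j ih =>
    intro N hN
    obtain ⟨g, hg⟩ := ih (N + 1) (by omega)
    have h1 := h.stable _ hg
    rw [Derivation.leibniz, h.derivation_pow_X2, smul_eq_mul, smul_eq_mul, Nat.add_sub_cancel] at h1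
    have hc : ((N + 1 : ℕ) : K) ≠ 0 := by exact_mod_cast Nat.succ_ne_zero N
    refine ⟨X 1 * g + C ((N + 1 : ℕ) : K)⁻¹ * D (X 1 ^ j * p + X 2 * g), mem_of_C_mul_mem hc ?_⟩
    convert h1 using 1
    have : C ((N + 1 : ℕ) : K) * C ((N + 1 : ℕ) : K)⁻¹ = (1 : MvPolynomial (Fin 3) K) := by
      rw [← C_mul, mul_inv_cancel₀ hc, C_1]
    have h2 : C ((N + 1 : ℕ) : K) = ((N + 1 : ℕ) : MvPolynomial (Fin 3) K) := map_natCast _ _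
    calc _ = X 2 ^ N * (C ((N + 1 : ℕ) : K) * (X 1 ^ (j + 1) * p + X 2 * (X 1 * g)) +
          (C ((N + 1 : ℕ) : K) * C ((N + 1 : ℕ) : K)⁻¹) *
            (X 2 * D (X 1 ^ j * p + X 2 * g))) := by ring
      _ = _ := by rw [this, h2]; ring

/-- Every monomial multiple of `p` of the right degree is a leading term of an element of `V`. -/
theorem exists_mem [CharZero K] (h : IsFlagStable V n m D D' p) (t : ℕ) : ∀ j N, t + j + N = n →
    ∃ g, X 2 ^ N * (X 0 ^ t * X 1 ^ j * p + X 2 * g) ∈ V := by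
  obtain ⟨c, hc⟩ := h.derivation'_p
  induction t with
  | zero =>
    intro j N hN
    simpa using h.exists_mem_X1_pow j N (by omega)
  | succ t ih =>
    intro j N hN
    obtain ⟨g, hg⟩ := ih (j + 1) N (by omega)
    -- D' - c acts as D' with p treated as a constant, so it trades one `X₁` for `X₀`.
    have h1 := V.sub_mem (h.stable' _ hg) (C_mul_mem c hg)
    have hj : ((j + 1 : ℕ) : K) ≠ 0 := by exact_mod_cast Nat.succ_ne_zero j
    refine ⟨C ((j + 1 : ℕ) : K)⁻¹ * (D' g - C c * g), mem_of_C_mul_mem hj ?_⟩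
    convert h1 using 1
    have : C ((j + 1 : ℕ) : K) * C ((j + 1 : ℕ) : K)⁻¹ = (1 : MvPolynomial (Fin 3) K) := by
      rw [← C_mul, mul_inv_cancel₀ hj, C_1]
    have h2 : C ((j + 1 : ℕ) : K) = ((j + 1 : ℕ) : MvPolynomial (Fin 3) K) := map_natCast _ _
    rw [mul_add (X 2 ^ N) (X 0 ^ t * X 1 ^ (j + 1) * p), map_add, h.derivation'_mul, hc]
    simp only [Derivation.leibniz, Derivation.leibniz_pow, h.map_X2', smul_eq_mul, smul_zero,
      mul_zero, add_zero, Nat.add_sub_cancel]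
    calc _ = X 2 ^ N * (C ((j + 1 : ℕ) : K) * (X 0 ^ (t + 1) * X 1 ^ j * p) +
          (C ((j + 1 : ℕ) : K) * C ((j + 1 : ℕ) : K)⁻¹) * (X 2 * (D' g - C c * g))) := by ring
      _ = _ := by rw [this, h2]; ring

/-- Division with remainder on the line: the `v t` realize all multiples of P needed for the
quotient, so the remainder is the restriction of a cofactor of an element of V. Its degree is below
m, and `lead` forces it to vanish. -/
theorem exists_sub_sum_mem (h : IsFlagStable V n m D D' p) {N : ℕ} (hN : N ≤ n)
    {g : MvPolynomial (Fin 3) K} (hg : X 2 ^ N * g ∈ V) {v : ℕ → MvPolynomial (Fin 3) K}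
    (hv : ∀ t ≤ n - N, X 2 ^ N * v t ∈ V ∧
      restrictLine K (v t) = Polynomial.X ^ t * restrictLine K p) :
    ∃ Q : Polynomial K,
      X 2 ^ N * (g - ∑ t ∈ Finset.range (n - N + 1), C (Q.coeff t) * v t) ∈ V ∧
      restrictLine K (g - ∑ t ∈ Finset.range (n - N + 1), C (Q.coeff t) * v t) = 0 ∧
      restrictLine K g = Q * restrictLine K p := by
  set P := restrictLine K p with hP
  set G := restrictLine K g
  have hGdeg : G.natDegree ≤ m + (n - N) := by
    by_cases hg0 : g = 0
    · simp [G, hg0]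
    · obtain ⟨e, he, hhom⟩ := h.homogeneous_right hg hg0
      have : G.natDegree ≤ e := natDegree_restrictLine_le hhom
      omega
  -- P has degree exactly m, so the quotient has degree at most n - N and the available `v t`
  -- suffice.
  have hQ : (G / P).natDegree < n - N + 1 := by
    rw [Polynomial.div_def]
    refine (Polynomial.natDegree_C_mul_le _ _).trans_lt ?_
    rw [Polynomial.natDegree_divByMonic _ (Polynomial.monic_mul_leadingCoeff_inv h.p_ne),
      Polynomial.natDegree_mul_leadingCoeff_inv _ h.p_ne, h.natDegree_p]
    omega
  have hmem : X 2 ^ N * (g - ∑ t ∈ Finset.range (n - N + 1), C ((G / P).coeff t) * v t) ∈ V := by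
    rw [mul_sub, Finset.mul_sum]
    refine V.sub_mem hg (V.sum_mem fun t ht => ?_)
    rw [mul_left_comm]
    exact C_mul_mem _ (hv t (by rw [Finset.mem_range] at ht; omega)).1
  have hres : restrictLine K (g - ∑ t ∈ Finset.range (n - N + 1), C ((G / P).coeff t) * v t) =
      G - (G / P) * P := by
    rw [map_sub, map_sum]
    congr 1
    conv_rhs => rw [Polynomial.as_sum_range_C_mul_X_pow' (G / P) hQ, Finset.sum_mul]
    refine Finset.sum_congr rfl fun t ht => ?_
    rw [map_mul, restrictLine_C, (hv t (by rw [Finset.mem_range] at ht; omega)).2, mul_assoc]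
  have hmod : G - (G / P) * P = G % P := by
    rw [sub_eq_iff_eq_add, mul_comm]; exact (EuclideanDomain.mod_add_div G P).symm
  have h0 : G % P = 0 := by
    by_contra hne
    have h1 := (h.lead _ _ hmem (by rwa [hres, hmod])).2
    rw [hres, hmod] at h1
    have h2 := EuclideanDomain.mod_lt G h.p_ne
    have h3 := Polynomial.natDegree_lt_natDegree hne h2
    rw [h.natDegree_p] at h3
    omega
  refine ⟨G / P, hmem, by rw [hres, hmod, h0], ?_⟩
  rw [← sub_eq_zero, hmod, h0]

theorem restrictLine_dvd [CharZero K] (h : IsFlagStable V n m D D' p) {N : ℕ} (hN : N ≤ n)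
    {g : MvPolynomial (Fin 3) K} (hg : X 2 ^ N * g ∈ V) : restrictLine K p ∣ restrictLine K g := by
  have hex : ∀ t, ∃ v, t ≤ n - N → X 2 ^ N * v ∈ V ∧
      restrictLine K v = Polynomial.X ^ t * restrictLine K p := by
    intro t
    by_cases ht : t ≤ n - N
    · obtain ⟨g', hg'⟩ := h.exists_mem t (n - N - t) N (by omega)
      exact ⟨_, fun _ => ⟨hg', by simp⟩⟩
    · exact ⟨0, fun h => absurd h ht⟩
  choose v hv using hex
  obtain ⟨Q, -, -, hQ⟩ := h.exists_sub_sum_mem hN hg hv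
  exact ⟨Q, by rw [hQ, mul_comm]⟩

/-- Iterating the operator `f ↦ D f - a * f` on `X₂^n * p`. -/
theorem exists_mem_iterate (h : IsFlagStable V n m D D' p) {N : ℕ} {a : K}
    {q : MvPolynomial (Fin 3) K} (hq : D p = C a * p + X 2 ^ N * q) (i : ℕ) : ∀ j, i + j = n →
    ∃ (c d : ℕ) (g : MvPolynomial (Fin 3) K), 0 < c ∧
      ((j * d : ℕ) : MvPolynomial (Fin 3) K) * X 2 ^ (j - 1) * X 1 ^ (i + 1) * p +
        (c : MvPolynomial (Fin 3) K) * X 2 ^ (j + N) * X 1 ^ i * q + X 2 ^ (j + N + 1) * g ∈ V := by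
  induction i with
  | zero =>
    intro j hj
    obtain rfl : j = n := by omega
    refine ⟨1, 1, 0, one_pos, ?_⟩
    have h1 := V.sub_mem (h.stable _ h.mem_p) (C_mul_mem a h.mem_p)
    convert h1 using 1
    rw [Derivation.leibniz, h.derivation_pow_X2, hq, smul_eq_mul, smul_eq_mul]
    push_cast
    ring
  | succ i ih =>
    intro j hj
    obtain ⟨c, d, g, hc, hmem⟩ := ih (j + 1) (by omega)
    have h1 := V.sub_mem (h.stable _ hmem) (C_mul_mem a hmem)
    -- The new q-term has two sources: D p in the first summand, and the derivative of `X₂^(j+1+N)`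
    -- in the second. Neither contribution is negative, so c stays positive.
    refine ⟨(j + 1) * d + c * (j + 1 + N), (j + 1) * d,
      (c : MvPolynomial (Fin 3) K) * X 1 ^ i * (D q - C a * q) +
        ((j + 1 + N + 1 : ℕ) : MvPolynomial (Fin 3) K) * X 1 * g + X 2 * (D g - C a * g),
      by positivity, ?_⟩
    convert h1 using 1
    simp only [map_add, Derivation.leibniz, Derivation.leibniz_pow, h.map_X1, h.map_X2, hq,
      Derivation.map_natCast, smul_eq_mul, nsmul_eq_mul, smul_zero, mul_zero, add_zero, zero_add,
      Nat.add_sub_cancel]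
    have e1 : j + 1 + N - 1 = j + N := by omega
    rw [e1]
    push_cast
    ring

theorem isHomogeneous_derivation_p (h : IsFlagStable V n m D D' p) : (D p).IsHomogeneous m := by
  by_cases h0 : D p = 0
  · rw [h0]; exact isHomogeneous_zero _ _ _
  have h1 := h.homogeneous _ (h.stable _ h.mem_p)
  rw [Derivation.leibniz, h.derivation_pow_X2, smul_eq_mul, smul_eq_mul] at h1
  have h2 : (p * ((n : MvPolynomial (Fin 3) K) * X 2 ^ (n - 1) * X 1)).IsHomogeneous (n + m) := by
    rcases Nat.eq_zero_or_pos n with hn | hn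
    · subst hn; simpa using isHomogeneous_zero _ _ _
    · rw [← map_natCast (C (σ := Fin 3) (R := K)), add_comm]
      refine h.homogeneous_p.mul ?_
      have := (isHomogeneous_C_mul_X_pow (n : K) (2 : Fin 3) (n - 1)).mul (isHomogeneous_X K 1)
      rwa [Nat.sub_add_cancel hn] at this
  have h3 := h1.sub h2
  rw [add_sub_cancel_right] at h3
  obtain ⟨j, hj, hj'⟩ := MvPolynomial.IsHomogeneous.of_mul_left
    (isHomogeneous_X_pow (2 : Fin 3) n) (pow_ne_zero _ (X_ne_zero _)) h3 h0
  obtain rfl : j = m := by omega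
  exact hj'

/-- The congruence D p ≡ a p improves by one power of `X₂` at a time. Iterating D - a until the
p-term disappears leaves an element of V with leading part `X₂^N X₁^n q`, so P divides q on the
line; comparing degrees, q is there a scalar multiple of p. -/
theorem exists_derivation_eq [CharZero K] (h : IsFlagStable V n m D D' p) (N : ℕ) :
    ∃ (a : K) (q : MvPolynomial (Fin 3) K), D p = C a * p + X 2 ^ N * q := by
  induction N with
  | zero => exact ⟨0, D p, by simp⟩
  | succ N ih =>
    obtain ⟨a, q, hq⟩ := ih
    by_cases hq0 : q = 0
    · exact ⟨a, 0, by rw [hq, hq0]; ring⟩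
    obtain ⟨e, he, hhom⟩ : ∃ e, N + e = m ∧ q.IsHomogeneous e := by
      refine MvPolynomial.IsHomogeneous.of_mul_left (isHomogeneous_X_pow (2 : Fin 3) N)
        (pow_ne_zero _ (X_ne_zero _)) (b := q) ?_ hq0
      have : X 2 ^ N * q = D p - C a * p := by rw [hq]; ring
      rw [this]
      exact h.isHomogeneous_derivation_p.sub (h.homogeneous_p.C_mul a)
    have hdeg := natDegree_restrictLine_le hhom
    have hdvd : restrictLine K p ∣ restrictLine K q := by
      -- For i = n and j = 0 the coefficient j d of the p-term is zero.
      obtain ⟨c, d, g, hc, hmem⟩ := h.exists_mem_iterate hq n 0 (by omega)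
      have hmem' : X 2 ^ N * ((c : MvPolynomial (Fin 3) K) * X 1 ^ n * q + X 2 * g) ∈ V := by
        convert hmem using 1
        simp only [zero_mul, Nat.cast_zero, zero_add]
        ring
      have hres : restrictLine K ((c : MvPolynomial (Fin 3) K) * X 1 ^ n * q + X 2 * g) =
          Polynomial.C (c : K) * restrictLine K q := by
        simp
      have hc' : IsUnit (Polynomial.C (c : K)) :=
        Polynomial.isUnit_C.mpr (IsUnit.mk0 _ (by exact_mod_cast hc.ne'))
      rcases le_or_gt N n with hN | hN
      · have := h.restrictLine_dvd hN hmem'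
        rwa [hres, hc'.dvd_mul_left] at this
      · rw [h.eq_zero_of_lt hmem' hN, map_zero, eq_comm, hc'.mul_right_eq_zero] at hres
        rw [hres]; exact dvd_zero _
    -- q has degree m - N and P has degree m, so the quotient is constant, and zero unless N = 0.
    obtain ⟨b, hb⟩ : ∃ b : K, restrictLine K q = Polynomial.C b * restrictLine K p ∧
        (N ≠ 0 → b = 0) := by
      obtain ⟨u, hu⟩ := hdvd
      by_cases hu0 : u = 0
      · exact ⟨0, by rw [hu, hu0]; simp, fun _ => rfl⟩
      have hd := congrArg Polynomial.natDegree hu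
      rw [Polynomial.natDegree_mul h.p_ne hu0, h.natDegree_p] at hd
      have hu' : u.natDegree = 0 := by omega
      refine ⟨u.coeff 0, ?_, fun hN => by omega⟩
      rw [hu, Polynomial.eq_C_of_natDegree_eq_zero hu']
      simp [mul_comm]
    have hqb : (q - C b * p).IsHomogeneous e := by
      rcases Nat.eq_zero_or_pos N with hN | hN
      · obtain rfl : e = m := by omega
        exact hhom.sub (h.homogeneous_p.C_mul b)
      · rw [hb.2 (by omega)]; simpa using hhom
    obtain ⟨r, hr⟩ := X2_dvd_of_restrictLine_eq_zero hqb (by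
      rw [map_sub, map_mul, restrictLine_C, hb.1, sub_self])
    rcases Nat.eq_zero_or_pos N with hN | hN
    · subst hN
      refine ⟨a + b, r, ?_⟩
      rw [hq, C_add]
      linear_combination hr
    · rw [hb.2 (by omega), C_0, zero_mul, sub_zero] at hr
      exact ⟨a, r, by rw [hq, hr]; ring⟩

theorem derivation_p [CharZero K] (h : IsFlagStable V n m D D' p) : ∃ a : K, D p = C a * p := by
  -- D p and p have degree m, leaving no room for a nonzero multiple of `X₂^(m+1)`.
  obtain ⟨a, q, hq⟩ := h.exists_derivation_eq (m + 1)
  refine ⟨a, ?_⟩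
  have hq0 : q = 0 := by
    by_contra hq0
    have hhom : (X 2 ^ (m + 1) * q).IsHomogeneous m := by
      have : X 2 ^ (m + 1) * q = D p - C a * p := by rw [hq]; ring
      rw [this]
      exact h.isHomogeneous_derivation_p.sub (h.homogeneous_p.C_mul a)
    obtain ⟨j, hj, -⟩ := MvPolynomial.IsHomogeneous.of_mul_left
      (isHomogeneous_X_pow (2 : Fin 3) (m + 1)) (pow_ne_zero _ (X_ne_zero _)) hhom hq0
    omega
  rw [hq, hq0, mul_zero, add_zero]

/-- With p an eigenvector of D, the argument of `exists_mem_X1_pow` becomes exact: D - a produces no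
error term. -/
theorem X1_pow_mul_p_mem [CharZero K] (h : IsFlagStable V n m D D' p) (j : ℕ) : ∀ N, j + N = n →
    X 2 ^ N * (X 1 ^ j * p) ∈ V := by
  obtain ⟨a, ha⟩ := h.derivation_p
  induction j with
  | zero =>
    intro N hN
    obtain rfl : N = n := by omega
    simpa using h.mem_p
  | succ j ih =>
    intro N hN
    have hmem := ih (N + 1) (by omega)
    have h1 := V.sub_mem (h.stable _ hmem) (C_mul_mem a hmem)
    have hc : ((N + 1 : ℕ) : K) ≠ 0 := by exact_mod_cast Nat.succ_ne_zero N
    refine mem_of_C_mul_mem hc ?_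
    convert h1 using 1
    have h2 : C ((N + 1 : ℕ) : K) = ((N + 1 : ℕ) : MvPolynomial (Fin 3) K) := map_natCast _ _
    rw [Derivation.leibniz, h.derivation_pow_X2, Derivation.leibniz, ha, Derivation.leibniz_pow,
      h.map_X1, h2]
    simp only [smul_eq_mul, Nat.add_sub_cancel]
    ring

theorem monomial_mul_p_mem [CharZero K] (h : IsFlagStable V n m D D' p) (t : ℕ) :
    ∀ j N, t + j + N = n → X 2 ^ N * (X 0 ^ t * X 1 ^ j * p) ∈ V := by
  obtain ⟨c, hc⟩ := h.derivation'_p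
  induction t with
  | zero =>
    intro j N hN
    simpa using h.X1_pow_mul_p_mem j N (by omega)
  | succ t ih =>
    intro j N hN
    have hmem := ih (j + 1) N (by omega)
    have h1 := V.sub_mem (h.stable' _ hmem) (C_mul_mem c hmem)
    have hj : ((j + 1 : ℕ) : K) ≠ 0 := by exact_mod_cast Nat.succ_ne_zero j
    refine mem_of_C_mul_mem hj ?_
    convert h1 using 1
    have h2 : C ((j + 1 : ℕ) : K) = ((j + 1 : ℕ) : MvPolynomial (Fin 3) K) := map_natCast _ _
    rw [h.derivation'_mul, hc, h2, Nat.add_sub_cancel]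
    ring

/-- Descending induction on the power of `X₂`: subtracting multiples of p already in V leaves an
element divisible by one more `X₂`, and beyond the n-th power nothing is left. -/
theorem dvd_X2_pow_mul [CharZero K] (h : IsFlagStable V n m D D' p) (e : ℕ) :
    ∀ N g, N + e = n + 1 → X 2 ^ N * g ∈ V → p ∣ X 2 ^ N * g := by
  induction e with
  | zero =>
    intro N g hN hg
    rw [h.eq_zero_of_lt hg (by omega), mul_zero]
    exact dvd_zero _
  | succ e ih =>
    intro N g hN hg
    have hv : ∀ t ≤ n - N, X 2 ^ N * (X 0 ^ t * X 1 ^ (n - N - t) * p) ∈ V ∧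
        restrictLine K (X 0 ^ t * X 1 ^ (n - N - t) * p) =
          Polynomial.X ^ t * restrictLine K p := fun t ht =>
      ⟨h.monomial_mul_p_mem t _ N (by omega), by simp⟩
    obtain ⟨Q, hmem, hres, -⟩ := h.exists_sub_sum_mem (by omega) hg hv
    obtain ⟨r, hr⟩ := h.X2_dvd hmem hres
    rw [hr, ← mul_assoc, ← pow_succ] at hmem
    have h1 := ih (N + 1) r (by omega) hmem
    have h2 : X 2 ^ N * g = X 2 ^ (N + 1) * r + X 2 ^ N * ∑ t ∈ Finset.range (n - N + 1),
        C (Q.coeff t) * (X 0 ^ t * X 1 ^ (n - N - t) * p) := by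
      linear_combination X 2 ^ N * hr
    rw [h2]
    exact dvd_add h1 (Dvd.dvd.mul_left (Finset.dvd_sum fun t _ =>
      ⟨C (Q.coeff t) * (X 0 ^ t * X 1 ^ (n - N - t)), by ring⟩) _)

/-- The form `p` divides all of `V`. -/
theorem dvd_of_mem [CharZero K] (h : IsFlagStable V n m D D' p) {f : MvPolynomial (Fin 3) K}
    (hf : f ∈ V) : p ∣ f := by
  have := h.dvd_X2_pow_mul (n + 1) 0 f (by omega)
  simp only [pow_zero, one_mul] at this
  exact this hf

end IsFlagStable

/-! ### Linear substitutions and inversion of the generic matrix -/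

/-- Substitution of the linear forms with coefficient matrix `N`. -/
noncomputable def linearSubst {k K σ τ : Type*} [Field k] [Field K] [Algebra k K] [Fintype τ]
    (N : σ → τ → K) : MvPolynomial σ k →ₐ[k] MvPolynomial τ K :=
  MvPolynomial.aeval fun i => ∑ j, MvPolynomial.C (N i j) * MvPolynomial.X j

theorem linearSubst_X {k K σ τ : Type*} [Field k] [Field K] [Algebra k K] [Fintype τ]
    (N : σ → τ → K) (i : σ) : linearSubst N (MvPolynomial.X i : MvPolynomial σ k) =
      ∑ j, MvPolynomial.C (N i j) * MvPolynomial.X j := MvPolynomial.aeval_X _ _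

theorem linearSubst_isHomogeneous {k K σ τ : Type*} [Field k] [Field K] [Algebra k K] [Fintype τ]
    (N : σ → τ → K) {f : MvPolynomial σ k} {d : ℕ} (hf : f.IsHomogeneous d) :
    (linearSubst N f).IsHomogeneous d := by
  have := hf.aeval (fun i => ∑ j, MvPolynomial.C (N i j) * MvPolynomial.X j) (n := 1) fun i =>
    MvPolynomial.IsHomogeneous.sum _ _ _ fun j _ => MvPolynomial.isHomogeneous_C_mul_X _ _
  rwa [one_mul] at this

section GenericMatrix

variable (k : Type*) [Field k] (s : ℕ)

theorem isUnit_det_genericMatrix : IsUnit (genericMatrix k s).det := by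
  have h : (genericMatrix k s).det = algebraMap (MvPolynomial (Fin s × Fin s) k)
      (GenericField k s) (Matrix.mvPolynomialX (Fin s) (Fin s) k).det := by
    rw [RingHom.map_det]; rfl
  rw [h, isUnit_iff_ne_zero, Ne, FaithfulSMul.algebraMap_eq_zero_iff]
  exact Matrix.det_mvPolynomialX_ne_zero _ _

/-- The algebra homomorphism `u ↦ u⁻¹`. -/
noncomputable def invCoord : MvPolynomial (Fin s × Fin s) k →ₐ[k] GenericField k s :=
  MvPolynomial.aeval fun ij => (genericMatrix k s)⁻¹ ij.1 ij.2

theorem map_inv_of_isUnit_det {A B : Type*} [CommRing A] [CommRing B] (f : A →+* B)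
    (N : Matrix (Fin s) (Fin s) A) (hN : IsUnit N.det) : N⁻¹.map f = (N.map f)⁻¹ := by
  symm
  apply Matrix.inv_eq_left_inv
  change f.mapMatrix N⁻¹ * f.mapMatrix N = 1
  rw [← map_mul, Matrix.nonsing_inv_mul _ hN, map_one]

/-- Inversion is an involution of `GL_s`. On the coordinate ring A, the polynomial ring with the
determinant inverted, φ sends u to the inverse matrix, ι embeds A in the function field, and ψ
extends `invCoord`. Then ψ ∘ φ is the inclusion of the polynomial ring, so φ is injective, and so is
`invCoord` = ι ∘ φ. -/
theorem invCoord_injective : Function.Injective (invCoord k s) := by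
  set d := (Matrix.mvPolynomialX (Fin s) (Fin s) k).det with hd
  have hd0 : d ≠ 0 := Matrix.det_mvPolynomialX_ne_zero _ _
  let A := Localization.Away d
  let UA : Matrix (Fin s) (Fin s) A :=
    (Matrix.mvPolynomialX (Fin s) (Fin s) k).map (algebraMap _ A)
  have hUA : IsUnit UA.det := by
    have : UA.det = algebraMap _ A d := by
      simp only [hd]
      exact (RingHom.map_det (algebraMap _ A) _).symm
    rw [this]
    exact IsLocalization.Away.algebraMap_isUnit d
  have hle : Submonoid.powers d ≤ nonZeroDivisors (MvPolynomial (Fin s × Fin s) k) :=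
    powers_le_nonZeroDivisors_of_noZeroDivisors hd0
  have hι : IsUnit (algebraMap (MvPolynomial (Fin s × Fin s) k) (GenericField k s) d) := by
    rw [isUnit_iff_ne_zero, Ne, FaithfulSMul.algebraMap_eq_zero_iff]; exact hd0
  let ι : A →+* GenericField k s := IsLocalization.Away.lift d hι
  have hιinj : Function.Injective ι := by
    apply (IsLocalization.lift_injective_iff _).mpr
    intro x y
    rw [(IsLocalization.injective A hle).eq_iff,
      (FaithfulSMul.algebraMap_injective _ (GenericField k s)).eq_iff]
  have hψ : IsUnit ((invCoord k s).toRingHom d) := by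
    have : (invCoord k s).toRingHom d = (genericMatrix k s)⁻¹.det := by
      rw [hd, RingHom.map_det]
      congr 1
      ext i j
      simp [invCoord, Matrix.mvPolynomialX]
    rw [this]
    exact Matrix.isUnit_nonsing_inv_det _ (isUnit_det_genericMatrix k s)
  let ψ : A →+* GenericField k s := IsLocalization.Away.lift d hψ
  let φ : MvPolynomial (Fin s × Fin s) k →ₐ[k] A :=
    MvPolynomial.aeval fun ij => UA⁻¹ ij.1 ij.2
  have hιU : UA.map ι = genericMatrix k s := by
    ext i j
    simp [UA, ι, genericMatrix]
  have hψU : UA.map ψ = (genericMatrix k s)⁻¹ := by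
    ext i j
    simp [UA, ψ, invCoord, Matrix.mvPolynomialX]
  have h1 : ι.comp φ.toRingHom = (invCoord k s).toRingHom := by
    apply MvPolynomial.ringHom_ext
    · intro a
      simp only [RingHom.comp_apply, AlgHom.toRingHom_eq_coe, RingHom.coe_coe,
        MvPolynomial.algHom_C]
      rw [IsScalarTower.algebraMap_apply k (MvPolynomial (Fin s × Fin s) k) A]
      simp only [ι, IsLocalization.Away.lift_eq]
      exact (IsScalarTower.algebraMap_apply k (MvPolynomial (Fin s × Fin s) k)
        (GenericField k s) a).symm
    · intro ij
      have := congrFun (congrFun (map_inv_of_isUnit_det s ι UA hUA) ij.1) ij.2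
      rw [hιU] at this
      simpa [φ, invCoord] using this
  have h2 : ψ.comp φ.toRingHom = algebraMap _ _ := by
    apply MvPolynomial.ringHom_ext
    · intro a
      simp only [RingHom.comp_apply, AlgHom.toRingHom_eq_coe, RingHom.coe_coe,
        MvPolynomial.algHom_C]
      rw [IsScalarTower.algebraMap_apply k (MvPolynomial (Fin s × Fin s) k) A]
      simp only [ψ, IsLocalization.Away.lift_eq]
      exact (invCoord k s).commutes a
    · intro ij
      have := congrFun (congrFun (map_inv_of_isUnit_det s ψ UA hUA) ij.1) ij.2
      rw [hψU, Matrix.nonsing_inv_nonsing_inv _ (isUnit_det_genericMatrix k s)] at this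
      simpa [φ, genericMatrix, Matrix.mvPolynomialX] using this
  rw [injective_iff_map_eq_zero]
  intro Q hQ
  have h3 : ι (φ Q) = 0 := by
    have := congrArg (fun f => f Q) h1
    simpa [hQ] using this
  have h4 : φ Q = 0 := hιinj (by rw [h3, map_zero])
  have h5 := congrArg (fun f => f Q) h2
  simp only [RingHom.comp_apply, AlgHom.toRingHom_eq_coe, RingHom.coe_coe, h4, map_zero] at h5
  exact (FaithfulSMul.algebraMap_eq_zero_iff _ _).mp h5.symm

/-- The endomorphism of the function field of `GL_s` induced by the inversion. -/
noncomputable def inversion : GenericField k s →+* GenericField k s :=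
  IsFractionRing.lift (g := (invCoord k s).toRingHom) (invCoord_injective k s)

theorem inversion_algebraMap (a : k) :
    inversion k s (algebraMap k (GenericField k s) a) = algebraMap k (GenericField k s) a := by
  rw [IsScalarTower.algebraMap_apply k (MvPolynomial (Fin s × Fin s) k), inversion,
    IsFractionRing.lift_algebraMap, ← IsScalarTower.algebraMap_apply]
  exact (invCoord k s).commutes a

theorem map_inversion_genericMatrix :
    (genericMatrix k s).map (inversion k s) = (genericMatrix k s)⁻¹ := by
  ext i j
  rw [Matrix.map_apply, genericMatrix, Matrix.map_apply, inversion, IsFractionRing.lift_algebraMap]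
  simp [invCoord, Matrix.mvPolynomialX, genericMatrix]

theorem map_inversion_genericMatrix_inv :
    (genericMatrix k s)⁻¹.map (inversion k s) = genericMatrix k s := by
  rw [map_inv_of_isUnit_det _ _ _ (isUnit_det_genericMatrix k s), map_inversion_genericMatrix,
    Matrix.nonsing_inv_nonsing_inv _ (isUnit_det_genericMatrix k s)]

theorem map_inversion_genericCoordChange (f : MvPolynomial (Fin s) k) :
    MvPolynomial.map (inversion k s) (genericCoordChange k s f) =
      linearSubst (genericMatrix k s) f := by
  have : (MvPolynomial.map (inversion k s)).comp (genericCoordChange k s).toRingHom =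
      (linearSubst (k := k) (genericMatrix k s)).toRingHom := by
    apply MvPolynomial.ringHom_ext
    · intro a
      simp [MvPolynomial.algebraMap_apply, inversion_algebraMap]
    · intro i
      have h := fun j => congrFun (congrFun (map_inversion_genericMatrix_inv k s) i) j
      simp only [Matrix.map_apply] at h
      simp [genericCoordChange, linearSubst, h]
  exact congrArg (fun φ => φ f) this

theorem map_inversion_linearSubst (f : MvPolynomial (Fin s) k) :
    MvPolynomial.map (inversion k s) (linearSubst (genericMatrix k s) f) =
      genericCoordChange k s f := by
  have : (MvPolynomial.map (inversion k s)).comp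
      (linearSubst (k := k) (genericMatrix k s)).toRingHom =
      (genericCoordChange k s).toRingHom := by
    apply MvPolynomial.ringHom_ext
    · intro a
      simp [MvPolynomial.algebraMap_apply, inversion_algebraMap]
    · intro i
      have h := fun j => congrFun (congrFun (map_inversion_genericMatrix k s) i) j
      simp only [Matrix.map_apply] at h
      simp [genericCoordChange, linearSubst, h]
  exact congrArg (fun φ => φ f) this

variable {k s}

/-- A field endomorphism applied to the coefficients leaves supports unchanged. -/
theorem initialExponents_span_subset {K : Type*} [Field K] (θ : K →+* K)
    {V : Set (MvPolynomial (Fin s) k)}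
    {γ₁ γ₂ : MvPolynomial (Fin s) k → MvPolynomial (Fin s) K}
    (h : ∀ f, MvPolynomial.map θ (γ₁ f) = γ₂ f) :
    initialExponents (Submodule.span K (γ₁ '' V)) ⊆
      initialExponents (Submodule.span K (γ₂ '' V)) := by
  rintro I ⟨f, hf, ⟨d, hd⟩, hI⟩
  refine ⟨MvPolynomial.map θ f, ?_, ⟨d, hd.map θ⟩, ?_⟩
  · clear hd hI
    induction hf using Submodule.span_induction with
    | mem x hx =>
      obtain ⟨v, hv, rfl⟩ := hx
      rw [h]
      exact Submodule.subset_span ⟨v, hv, rfl⟩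
    | zero => simp
    | add x y _ _ hx hy => rw [map_add]; exact Submodule.add_mem _ hx hy
    | smul a x _ hx =>
      rw [MvPolynomial.smul_eq_C_mul, map_mul, MvPolynomial.map_C, ← MvPolynomial.smul_eq_C_mul]
      exact Submodule.smul_mem _ _ hx
  · unfold IsInitialExponent
    rwa [MvPolynomial.support_map_of_injective _ θ.injective]

theorem initialExponents_linearSubst (V : Set (MvPolynomial (Fin s) k)) :
    initialExponents (Submodule.span (GenericField k s) (linearSubst (genericMatrix k s) '' V)) =
      initialExponents (Submodule.span (GenericField k s) (genericCoordChange k s '' V)) :=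
  (initialExponents_span_subset _ (map_inversion_linearSubst k s)).antisymm
    (initialExponents_span_subset _ (map_inversion_genericCoordChange k s))

end GenericMatrix

/-! ### Derivations lifting infinitesimal coordinate changes -/

section Derivations

/-- The derivation given by a section of `A[ε] → A`. -/
noncomputable def derivationOfSection {k A : Type*} [CommRing k] [CommRing A] [Algebra k A]
    (Φ : A →ₐ[k] TrivSqZeroExt A A) (h : ∀ a, (Φ a).fst = a) : Derivation k A A :=
  Derivation.mk' ((TrivSqZeroExt.sndHom A A).restrictScalars k ∘ₗ Φ.toLinearMap) fun a b => by
    change (Φ (a * b)).snd = a • (Φ b).snd + b • (Φ a).snd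
    rw [map_mul, TrivSqZeroExt.snd_mul, h, h, op_smul_eq_smul]

theorem derivationOfSection_apply {k A : Type*} [CommRing k] [CommRing A] [Algebra k A]
    (Φ : A →ₐ[k] TrivSqZeroExt A A) (h : ∀ a, (Φ a).fst = a) (a : A) :
    derivationOfSection Φ h a = (Φ a).snd := rfl

/-- A vector field on affine space extends to the function field. -/
theorem exists_section_of_isFractionRing {k τ K : Type*} [Field k] [Field K]
    [Algebra (MvPolynomial τ k) K] [Algebra k K] [IsScalarTower k (MvPolynomial τ k) K]
    [IsFractionRing (MvPolynomial τ k) K] (c : τ → K) :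
    ∃ Φ : K →ₐ[k] TrivSqZeroExt K K, (∀ a, (Φ a).fst = a) ∧
      ∀ t, (Φ (algebraMap (MvPolynomial τ k) K (MvPolynomial.X t))).snd = c t := by
  let Φ₀ : MvPolynomial τ k →ₐ[k] TrivSqZeroExt K K :=
    MvPolynomial.aeval fun t =>
      TrivSqZeroExt.inl (algebraMap (MvPolynomial τ k) K (MvPolynomial.X t)) +
        TrivSqZeroExt.inr (c t)
  have hfst : ∀ x, (Φ₀ x).fst = algebraMap _ K x := by
    intro x
    have : (TrivSqZeroExt.fstHom k K K).comp Φ₀ =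
        IsScalarTower.toAlgHom k (MvPolynomial τ k) K := by
      apply MvPolynomial.algHom_ext
      intro t
      simp [Φ₀]
    exact congrArg (fun φ => φ x) this
  -- A dual number is a unit as soon as its constant part is, so the section extends to fractions.
  have hunit : ∀ y : nonZeroDivisors (MvPolynomial τ k), IsUnit (Φ₀.toRingHom y) := by
    intro y
    change IsUnit (Φ₀ y)
    rw [TrivSqZeroExt.isUnit_iff_isUnit_fst, hfst]
    exact IsLocalization.map_units K y
  let Φ : K →+* TrivSqZeroExt K K := IsLocalization.lift hunit
  have hΦ : ∀ x, Φ (algebraMap _ K x) = Φ₀ x := fun x => IsLocalization.lift_eq hunit x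
  have hΦk : ∀ a : k, Φ (algebraMap k K a) = algebraMap k _ a := by
    intro a
    rw [IsScalarTower.algebraMap_apply k (MvPolynomial τ k) K, hΦ, AlgHom.commutes]
  refine ⟨{ Φ with commutes' := hΦk }, ?_, ?_⟩
  · intro x
    have : (TrivSqZeroExt.fstHom K K K).toRingHom.comp Φ = RingHom.id K := by
      apply IsLocalization.ringHom_ext (nonZeroDivisors (MvPolynomial τ k))
      refine RingHom.ext fun x => ?_
      change (Φ (algebraMap _ K x)).fst = _
      rw [hΦ, hfst]
      rfl
    exact congrArg (fun φ => φ x) this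
  · intro t
    change (Φ _).snd = _
    rw [hΦ]
    simp only [Φ₀, MvPolynomial.aeval_X, TrivSqZeroExt.snd_add, TrivSqZeroExt.snd_inl,
      TrivSqZeroExt.snd_inr, zero_add]

/-- Extension of a derivation of the coefficients to a polynomial ring. -/
theorem exists_derivation_mvPolynomial {k K σ : Type*} [Field k] [Field K] [Algebra k K]
    (φ : K →ₐ[k] TrivSqZeroExt K K) (hφ : ∀ a, (φ a).fst = a) (w : σ → MvPolynomial σ K) :
    ∃ D : Derivation k (MvPolynomial σ K) (MvPolynomial σ K),
      (∀ a, D (MvPolynomial.C a) = MvPolynomial.C (φ a).snd) ∧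
        ∀ i, D (MvPolynomial.X i) = w i := by
  let R := MvPolynomial σ K
  let Φ₀ : K →+* TrivSqZeroExt R R :=
    { toFun := fun a => TrivSqZeroExt.inl (MvPolynomial.C a) +
        TrivSqZeroExt.inr (MvPolynomial.C (φ a).snd)
      map_one' := TrivSqZeroExt.ext (by simp) (by simp)
      map_zero' := TrivSqZeroExt.ext (by simp) (by simp)
      map_add' := fun a b => TrivSqZeroExt.ext (by simp) (by simp)
      map_mul' := fun a b => TrivSqZeroExt.ext (by simp) (by simp [hφ]) }
  let Φ : R →+* TrivSqZeroExt R R := MvPolynomial.eval₂Hom Φ₀ fun i =>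
    TrivSqZeroExt.inl (MvPolynomial.X i) + TrivSqZeroExt.inr (w i)
  have hC : ∀ a, Φ (MvPolynomial.C a) = TrivSqZeroExt.inl (MvPolynomial.C a) +
      TrivSqZeroExt.inr (MvPolynomial.C (φ a).snd) := fun a => MvPolynomial.eval₂Hom_C _ _ _
  have hX : ∀ i, Φ (MvPolynomial.X i) = TrivSqZeroExt.inl (MvPolynomial.X i) +
      TrivSqZeroExt.inr (w i) := fun i => MvPolynomial.eval₂Hom_X' _ _ _
  have hΦf : ∀ x, (Φ x).fst = x := by
    intro x
    have : (TrivSqZeroExt.fstHom R R R).toRingHom.comp Φ = RingHom.id R := by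
      apply MvPolynomial.ringHom_ext
      · intro a
        change (Φ (MvPolynomial.C a)).fst = _
        rw [hC, TrivSqZeroExt.fst_add, TrivSqZeroExt.fst_inl, TrivSqZeroExt.fst_inr, add_zero]
        rfl
      · intro i
        change (Φ (MvPolynomial.X i)).fst = _
        rw [hX, TrivSqZeroExt.fst_add, TrivSqZeroExt.fst_inl, TrivSqZeroExt.fst_inr, add_zero]
        rfl
    exact congrArg (fun φ => φ x) this
  have hΦk : ∀ a : k, Φ (algebraMap k R a) = algebraMap k _ a := by
    intro a
    rw [MvPolynomial.algebraMap_apply, hC, AlgHom.commutes]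
    refine TrivSqZeroExt.ext ?_ ?_
    · simp [TrivSqZeroExt.algebraMap_eq_inl']
      rfl
    · simp [TrivSqZeroExt.algebraMap_eq_inl']
  refine ⟨derivationOfSection { Φ with commutes' := hΦk } hΦf, ?_, ?_⟩
  · intro a
    rw [derivationOfSection_apply]
    change (Φ _).snd = _
    rw [hC, TrivSqZeroExt.snd_add, TrivSqZeroExt.snd_inl,
      TrivSqZeroExt.snd_inr, zero_add]
  · intro i
    rw [derivationOfSection_apply]
    change (Φ _).snd = _
    rw [hX, TrivSqZeroExt.snd_add, TrivSqZeroExt.snd_inl,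
      TrivSqZeroExt.snd_inr, zero_add]

/-- For algebraically independent entries of `N`, the infinitesimal coordinate change `X b ↦ X a`
lifts to a derivation killing the image of `linearSubst N`. -/
theorem exists_derivation_linearSubst {k K σ τ υ : Type*} [Field k] [Field K] [Fintype τ]
    [DecidableEq τ] [Algebra (MvPolynomial υ k) K] [Algebra k K]
    [IsScalarTower k (MvPolynomial υ k) K] [IsFractionRing (MvPolynomial υ k) K]
    (N : σ → τ → K) (e : σ → τ → υ) (he : Function.Injective2 e)
    (hN : ∀ i j, N i j = algebraMap (MvPolynomial υ k) K (MvPolynomial.X (e i j))) (a b : τ) :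
    ∃ D : Derivation k (MvPolynomial τ K) (MvPolynomial τ K),
      (∀ x, ∃ y, D (MvPolynomial.C x) = MvPolynomial.C y) ∧
      (∀ j, D (MvPolynomial.X j) = if j = b then MvPolynomial.X a else 0) ∧
      ∀ f : MvPolynomial σ k, D (linearSubst N f) = 0 := by
  classical
  -- The entries in column a move by minus column b and all other variables are fixed; this
  -- compensates `X_b ↦ X_a` in each form `∑ N i j X_j`.
  obtain ⟨φ, hφ, hφX⟩ := exists_section_of_isFractionRing (k := k) (τ := υ) (K := K)
    fun t : υ => if h : ∃ i, t = e i a then - N h.choose b else 0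
  obtain ⟨D, hDC, hDX⟩ := exists_derivation_mvPolynomial φ hφ fun j : τ =>
    if j = b then MvPolynomial.X a else 0
  refine ⟨D, fun x => ⟨_, hDC x⟩, hDX, ?_⟩
  have hφN : ∀ i j, (φ (N i j)).snd = if j = a then - N i b else 0 := by
    intro i j
    rw [hN, hφX]
    split_ifs with h1 h2 h2
    · exact congrArg (fun x => - N x b) (he h1.choose_spec).1.symm
    · exact absurd (he h1.choose_spec).2 h2
    · exact absurd ⟨i, by rw [h2]⟩ h1
    · rfl
  intro f
  induction f using MvPolynomial.induction_on with
  | C x =>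
    rw [MvPolynomial.algHom_C, Derivation.map_algebraMap]
  | add p q hp hq => rw [map_add, map_add, hp, hq, add_zero]
  | mul_X p i hp =>
    rw [map_mul, Derivation.leibniz, hp, smul_zero, add_zero]
    have : D (linearSubst N (MvPolynomial.X i : MvPolynomial σ k)) = 0 := by
      simp only [linearSubst_X, map_sum, Derivation.leibniz, hDC, hDX, hφN, smul_eq_mul,
        Finset.sum_add_distrib]
      simp [apply_ite, mul_comm]
    rw [this, smul_zero]

end Derivations

/-! ### Initial exponents read off from the generic initial space -/

section GinExponents

variable {k : Type*} [Field k] {s : ℕ}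

theorem monomial_mem_span_iff (E : Set (Fin s →₀ ℕ)) (I : Fin s →₀ ℕ) :
    MvPolynomial.monomial I (1 : k) ∈
      Submodule.span k ((fun I : Fin s →₀ ℕ => MvPolynomial.monomial I (1 : k)) '' E) ↔ I ∈ E := by
  have h := (MvPolynomial.basisMonomials (Fin s) k).mem_span_image
    (m := MvPolynomial.monomial I (1 : k)) (s := E)
  rw [MvPolynomial.coe_basisMonomials] at h
  rw [h, ← congrFun (MvPolynomial.coe_basisMonomials (Fin s) k) I, Module.Basis.repr_self]
  simp

theorem span_monomial_injective :
    Function.Injective fun E : Set (Fin s →₀ ℕ) => Submodule.span k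
      ((fun I : Fin s →₀ ℕ => MvPolynomial.monomial I (1 : k)) '' E) := by
  intro E F h
  ext I
  rw [← monomial_mem_span_iff (k := k) E, ← monomial_mem_span_iff (k := k) F]
  simp only at h
  rw [h]

/-- Exponents of the monomials of degree `n` in the first `r` variables. -/
def firstExponents (s r n : ℕ) : Set (Fin s →₀ ℕ) :=
  {J | J.degree = n ∧ ∀ i : Fin s, r ≤ (i : ℕ) → J i = 0}

theorem firstVars_pow (r n : ℕ) : firstVars k s r ^ n = Submodule.span k
    ((fun I : Fin s →₀ ℕ => MvPolynomial.monomial I (1 : k)) '' firstExponents s r n) := by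
  induction n with
  | zero =>
    have : firstExponents s r 0 = {0} := by
      ext J
      simp only [firstExponents, Finsupp.degree_eq_zero_iff, Set.mem_ofPred_eq,
        Set.mem_singleton_iff]
      exact ⟨fun h => h.1, fun h => ⟨h, fun i _ => by rw [h]; rfl⟩⟩
    rw [this, pow_zero, Set.image_singleton, Submodule.one_eq_span]
    rfl
  | succ n ih =>
    rw [pow_succ, ih, firstVars, Submodule.span_mul_span]
    congr 1
    ext f
    constructor
    · rintro ⟨_, ⟨J, hJ, rfl⟩, _, ⟨i, hi, rfl⟩, rfl⟩
      refine ⟨J + Finsupp.single i 1, ⟨?_, ?_⟩, ?_⟩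
      · rw [map_add, hJ.1, Finsupp.degree_single]
      · intro j hj
        have hij : i ≠ j := by
          rintro rfl
          omega
        rw [Finsupp.add_apply, hJ.2 j hj, Finsupp.single_apply, if_neg hij,
          add_zero]
      · simp [MvPolynomial.X, MvPolynomial.monomial_mul]
    · rintro ⟨J, ⟨hJ, hJr⟩, rfl⟩
      obtain ⟨i, hi⟩ : ∃ i, J i ≠ 0 := by
        by_contra! h
        have : J = 0 := Finsupp.ext h
        rw [this] at hJ
        simp at hJ
      have hle : Finsupp.single i 1 ≤ J := by
        rw [Finsupp.single_le_iff]; omega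
      have hJ' : J - Finsupp.single i 1 + Finsupp.single i 1 = J := tsub_add_cancel_of_le hle
      refine ⟨_, ⟨J - Finsupp.single i 1, ⟨?_, ?_⟩, rfl⟩, _, ⟨i, ?_, rfl⟩, ?_⟩
      · have := congrArg Finsupp.degree hJ'
        rw [map_add, hJ, Finsupp.degree_single] at this
        omega
      · intro j hj
        rw [Finsupp.tsub_apply, hJr j hj, Nat.zero_sub]
      · by_contra! h
        exact hi (hJr i h)
      · simp [MvPolynomial.X, MvPolynomial.monomial_mul, hJ']

/-- The exponents of the initial monomials of `V` in generic coordinates. -/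
theorem initialExponents_of_gin {n m r : ℕ} (hs : 0 < s)
    (V : Submodule k (MvPolynomial (Fin s) k))
    (hgin : gin V = mulForm (firstVars k s r ^ n) (MvPolynomial.X (⟨0, hs⟩ : Fin s) ^ m)) :
    initialExponents (Submodule.span (GenericField k s)
      (linearSubst (genericMatrix k s) '' (V : Set (MvPolynomial (Fin s) k)))) =
        (fun J => J + Finsupp.single ⟨0, hs⟩ m) '' firstExponents s r n := by
  rw [initialExponents_linearSubst]
  apply span_monomial_injective (k := k)
  simp only
  rw [gin] at hgin
  rw [hgin, mulForm, firstVars_pow, Submodule.map_span, Set.image_image, Set.image_image]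
  congr 1
  refine Set.image_congr fun J _ => ?_
  simp [MvPolynomial.X_pow_eq_monomial, MvPolynomial.monomial_mul]

end GinExponents

/-! ### Restriction to the generic plane -/

section Plane

open MvPolynomial

variable {k : Type*} [Field k] {s : ℕ}

/-- Restriction of forms to the generic plane, with its generic coordinates. -/
noncomputable def planeRestriction (k : Type*) [Field k] {s : ℕ} (hs : 3 ≤ s) :
    MvPolynomial (Fin s) k →ₐ[k] MvPolynomial (Fin 3) (GenericField k s) :=
  linearSubst fun i j => genericMatrix k s i (Fin.castLE hs j)

theorem killCompl_linearSubst (hs : 3 ≤ s) (f : MvPolynomial (Fin s) k) :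
    killCompl (Fin.castLE_injective hs) (linearSubst (genericMatrix k s) f) =
      planeRestriction k hs f := by
  have : ((killCompl (R := GenericField k s) (Fin.castLE_injective hs)).restrictScalars k).comp
      (linearSubst (genericMatrix k s)) = planeRestriction k hs := by
    apply MvPolynomial.algHom_ext
    intro i
    change killCompl (Fin.castLE_injective hs) (linearSubst _ (X i)) = linearSubst _ (X i)
    have h1 : linearSubst (genericMatrix k s) (X i : MvPolynomial (Fin s) k) =
        ∑ j, C (genericMatrix k s i j) * X j := linearSubst_X _ i
    rw [h1]
    simp only [linearSubst_X, map_sum, map_mul, killCompl_C]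
    symm
    refine Finset.sum_of_injOn (Fin.castLE hs) (Fin.castLE_injective hs).injOn (by simp) ?_ ?_
    · intro j _ hj
      unfold killCompl
      rw [aeval_X, dif_neg, mul_zero]
      simpa using hj
    · intro j _
      rw [← rename_X (Fin.castLE hs), killCompl_rename_app]
  exact congrArg (fun φ => φ f) this

theorem span_planeRestriction (hs : 3 ≤ s) (V : Set (MvPolynomial (Fin s) k)) :
    Submodule.span (GenericField k s) (planeRestriction k hs '' V) =
      (Submodule.span (GenericField k s) (linearSubst (genericMatrix k s) '' V)).map
        (killCompl (R := GenericField k s) (Fin.castLE_injective hs)).toLinearMap := by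
  rw [Submodule.map_span, Set.image_image]
  congr 1
  exact Set.image_congr fun f _ => (killCompl_linearSubst hs f).symm

theorem coeff_X_pow_mul_add {σ R : Type*} [CommRing R] (i : σ) (N : ℕ) (g : MvPolynomial σ R)
    (I : σ →₀ ℕ) : coeff (Finsupp.single i N + I) (X i ^ N * g) = coeff I g := by
  rw [X_pow_eq_monomial, coeff_monomial_mul, one_mul]

theorem eq_zero_or_exists_le_three (hs : 3 ≤ s) (J : Fin s →₀ ℕ) :
    (∃ t : Fin s, 3 ≤ (t : ℕ) ∧ J t ≠ 0 ∧ ∀ j, t < j → J j = 0) ∨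
      ∃ J' : Fin 3 →₀ ℕ, J = J'.mapDomain (Fin.castLE hs) := by
  by_cases h : ∃ t : Fin s, 3 ≤ (t : ℕ) ∧ J t ≠ 0
  · left
    obtain ⟨t₀, ht₀⟩ := h
    obtain ⟨t, ht, hmax⟩ :=
      (Finset.univ.filter fun t : Fin s => 3 ≤ (t : ℕ) ∧ J t ≠ 0).exists_max_image id
        ⟨t₀, by simpa using ht₀⟩
    simp only [Finset.mem_filter, Finset.mem_univ, true_and] at ht hmax
    refine ⟨t, ht.1, ht.2, fun j hj => ?_⟩
    by_contra hne
    exact absurd (hmax j ⟨by have : (t : ℕ) < j := hj; omega, hne⟩) (not_le.mpr hj)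
  · right
    push Not at h
    refine ⟨J.comapDomain (Fin.castLE hs) (Fin.castLE_injective hs).injOn, ?_⟩
    rw [Finsupp.mapDomain_comapDomain _ (Fin.castLE_injective hs)]
    intro t ht
    by_contra hne
    refine Finsupp.mem_support_iff.mp ht (h t ?_)
    by_contra! hlt
    exact hne ⟨⟨t, hlt⟩, rfl⟩

/-- For forms of the same degree, the revlex order only depends on the restriction to the first
three variables as soon as one of the exponents is supported there. -/
theorem isInitialExponent_of_killCompl (hs : 3 ≤ s) {K : Type*} [Field K]
    {F : MvPolynomial (Fin s) K} {I : Fin 3 →₀ ℕ}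
    (hI : I ∈ (killCompl (Fin.castLE_injective hs) F).support)
    (hmax : ∀ J ∈ (killCompl (Fin.castLE_injective hs) F).support, J ≠ I → RevLexLT J I) :
    IsInitialExponent F (I.mapDomain (Fin.castLE hs)) := by
  have hinj := Fin.castLE_injective hs
  have happ : ∀ (J : Fin 3 →₀ ℕ) (j : Fin 3),
      J.mapDomain (Fin.castLE hs) (Fin.castLE hs j) = J j := fun J j =>
    Finsupp.mapDomain_apply hinj J j
  have hzero : ∀ (J : Fin 3 →₀ ℕ) (j : Fin s), 3 ≤ (j : ℕ) →
      J.mapDomain (Fin.castLE hs) j = 0 := by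
    intro J j hj
    apply Finsupp.mapDomain_of_notMem_range
    rintro ⟨i, rfl⟩
    have := i.2
    simp at hj
    omega
  refine ⟨?_, ?_⟩
  · rw [mem_support_iff] at hI ⊢
    rwa [coeff_killCompl] at hI
  · intro J hJ hne
    rcases eq_zero_or_exists_le_three hs J with ⟨t, ht, ht0, htmax⟩ | ⟨J', rfl⟩
    · refine ⟨t, ?_, fun j hj => ?_⟩
      · rw [hzero I t ht]; omega
      · rw [htmax j hj, hzero I j (by have : (t : ℕ) < j := hj; omega)]
    · obtain ⟨t, ht, ht'⟩ := hmax J' (by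
        rw [mem_support_iff, coeff_killCompl]
        exact mem_support_iff.mp hJ) (fun h => hne (by rw [h]))
      refine ⟨Fin.castLE hs t, by rwa [happ, happ], fun j hj => ?_⟩
      by_cases hj3 : (j : ℕ) < 3
      · have : j = Fin.castLE hs ⟨j, hj3⟩ := rfl
        rw [this, happ, happ]
        exact ht' _ hj
      · rw [hzero _ _ (by omega), hzero _ _ (by omega)]

end Plane

/-! ### Flag stability of the restricted space -/

section PlaneStable

open MvPolynomial

variable {k : Type*} [Field k] {s : ℕ}

/-- D kills the generators and sends scalars to scalars, so by the Leibniz rule it preserves their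
span. -/
theorem derivation_mem_span_planeRestriction {hs : 3 ≤ s} {V : Set (MvPolynomial (Fin s) k)}
    {D : Derivation k (MvPolynomial (Fin 3) (GenericField k s))
      (MvPolynomial (Fin 3) (GenericField k s))}
    (hDC : ∀ x, ∃ y, D (C x) = C y) (hD : ∀ f, D (planeRestriction k hs f) = 0)
    {f : MvPolynomial (Fin 3) (GenericField k s)}
    (hf : f ∈ Submodule.span (GenericField k s) (planeRestriction k hs '' V)) :
    D f ∈ Submodule.span (GenericField k s) (planeRestriction k hs '' V) := by
  induction hf using Submodule.span_induction with
  | mem x hx =>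
    obtain ⟨v, -, rfl⟩ := hx
    rw [hD]
    exact Submodule.zero_mem _
  | zero => rw [map_zero]; exact Submodule.zero_mem _
  | add x y _ _ hx hy => rw [map_add]; exact Submodule.add_mem _ hx hy
  | smul a x hx hDx =>
    obtain ⟨y, hy⟩ := hDC a
    rw [MvPolynomial.smul_eq_C_mul, Derivation.leibniz, hy, smul_eq_mul, smul_eq_mul,
      ← MvPolynomial.smul_eq_C_mul, mul_comm x, ← MvPolynomial.smul_eq_C_mul]
    exact Submodule.add_mem _ (Submodule.smul_mem _ _ hDx) (Submodule.smul_mem _ _ hx)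

theorem exists_derivation_planeRestriction (hs : 3 ≤ s) (a b : Fin 3) :
    ∃ D : Derivation k (MvPolynomial (Fin 3) (GenericField k s))
        (MvPolynomial (Fin 3) (GenericField k s)),
      (∀ x, ∃ y, D (C x) = C y) ∧ (∀ j, D (X j) = if j = b then X a else 0) ∧
      ∀ f : MvPolynomial (Fin s) k, D (planeRestriction k hs f) = 0 := by
  refine exists_derivation_linearSubst _ (fun i j => (i, Fin.castLE hs j)) ?_ ?_ a b
  · rintro i i' j j' h
    rw [Prod.mk.injEq] at h
    exact ⟨h.1, Fin.castLE_injective hs h.2⟩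
  · intro i j
    rfl

theorem span_planeRestriction_isHomogeneous {hs : 3 ≤ s} {d : ℕ}
    {V : Submodule k (MvPolynomial (Fin s) k)} (hV : V ≤ homogeneousSubmodule (Fin s) k d)
    {f : MvPolynomial (Fin 3) (GenericField k s)}
    (hf : f ∈ Submodule.span (GenericField k s) (planeRestriction k hs '' V)) :
    f.IsHomogeneous d := by
  have : Submodule.span (GenericField k s) (planeRestriction k hs '' V) ≤
      homogeneousSubmodule (Fin 3) (GenericField k s) d := by
    rw [Submodule.span_le]
    rintro _ ⟨v, hv, rfl⟩
    exact linearSubst_isHomogeneous _ (hV hv)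
  exact this hf

theorem span_linearSubst_isHomogeneous {d : ℕ}
    {V : Submodule k (MvPolynomial (Fin s) k)} (hV : V ≤ homogeneousSubmodule (Fin s) k d)
    {f : MvPolynomial (Fin s) (GenericField k s)}
    (hf : f ∈ Submodule.span (GenericField k s) (linearSubst (genericMatrix k s) ''
      (V : Set (MvPolynomial (Fin s) k)))) : f.IsHomogeneous d := by
  have : Submodule.span (GenericField k s)
      (linearSubst (genericMatrix k s) '' (V : Set (MvPolynomial (Fin s) k))) ≤
      homogeneousSubmodule (Fin s) (GenericField k s) d := by
    rw [Submodule.span_le]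
    rintro _ ⟨v, hv, rfl⟩
    exact linearSubst_isHomogeneous _ (hV hv)
  exact this hf

theorem degree_eq_of_mem_support {σ R : Type*} [CommRing R] {f : MvPolynomial σ R} {d : ℕ}
    (hf : f.IsHomogeneous d) {I : σ →₀ ℕ} (hI : I ∈ f.support) : I.degree = d := by
  rw [Finsupp.degree_eq_weight_one]
  exact hf (mem_support_iff.mp hI)

/-- The leading exponent of a ternary form, read off from its restriction to a line. -/
theorem exists_leading_exponent {K : Type*} [Field K] {N d : ℕ} {g : MvPolynomial (Fin 3) K}
    (hhom : (X 2 ^ N * g).IsHomogeneous d) (hg : restrictLine K g ≠ 0) :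
    ∃ I : Fin 3 →₀ ℕ, I ∈ (X 2 ^ N * g).support ∧ I 0 = (restrictLine K g).natDegree ∧ I 2 = N ∧
      ∀ J ∈ (X 2 ^ N * g).support, J ≠ I → RevLexLT J I := by
  have hg0 : g ≠ 0 := fun h => hg (by rw [h, map_zero])
  obtain ⟨e, he, hge⟩ := MvPolynomial.IsHomogeneous.of_mul_left (isHomogeneous_X_pow 2 N)
    (pow_ne_zero _ (X_ne_zero _)) hhom hg0
  set a := (restrictLine K g).natDegree with ha
  have hae : a ≤ e := natDegree_restrictLine_le hge
  -- Revlex prefers the least power of `X₂`, then the least power of `X₁`, that is, the largest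
  -- power a of `X₀`; the degree fixes the middle exponent.
  let I₀ : Fin 3 →₀ ℕ := Finsupp.equivFunOnFinite.symm ![a, e - a, 0]
  have hI₀ : I₀.degree = e := by
    rw [Finsupp.degree_eq_sum, Fin.sum_univ_three]
    simp [I₀]
    omega
  have hI₀c : coeff I₀ g ≠ 0 := by
    rw [← coeff_restrictLine hge hI₀ (by simp [I₀])]
    change (restrictLine K g).coeff a ≠ 0
    rwa [ha, Polynomial.coeff_natDegree, Polynomial.leadingCoeff_ne_zero]
  refine ⟨Finsupp.single 2 N + I₀, ?_, ?_, ?_, ?_⟩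
  · rw [mem_support_iff, coeff_X_pow_mul_add]
    exact hI₀c
  · simp [I₀]
  · simp [I₀]
  · intro J hJ hne
    have hJN : Finsupp.single 2 N ≤ J := by
      by_contra h
      rw [mem_support_iff, X_pow_eq_monomial, coeff_monomial_mul', if_neg h] at hJ
      exact hJ rfl
    obtain ⟨J', rfl⟩ : ∃ J', J = Finsupp.single 2 N + J' := ⟨_, (add_tsub_cancel_of_le hJN).symm⟩
    rw [mem_support_iff, coeff_X_pow_mul_add] at hJ
    have hJ' : J'.degree = e := degree_eq_of_mem_support hge (mem_support_iff.mpr hJ)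
    have hJs := hJ'
    rw [Finsupp.degree_eq_sum, Fin.sum_univ_three] at hJs
    by_cases h2 : J' 2 = 0
    · have h0 : J' 0 ≤ a := by
        apply Polynomial.le_natDegree_of_ne_zero
        rwa [coeff_restrictLine hge hJ' h2]
      have h0' : J' 0 ≠ a := by
        intro h0'
        apply hne
        congr 1
        ext i
        fin_cases i
        · exact h0'
        · change J' 1 = e - a
          omega
        · exact h2
      refine ⟨1, ?_, ?_⟩
      · simp [I₀]
        omega
      · intro j hj
        obtain rfl : j = 2 := by omega
        simp [I₀, h2]
    · refine ⟨2, ?_, ?_⟩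
      · simp [I₀]
        omega
      · intro j hj
        omega

theorem isFlagStable_planeRestriction {n m r : ℕ} (hs : 3 ≤ s) (hr : 3 ≤ r)
    {V : Submodule k (MvPolynomial (Fin s) k)} (hV : V ≤ homogeneousSubmodule (Fin s) k (n + m))
    (hE : initialExponents (Submodule.span (GenericField k s)
      (linearSubst (genericMatrix k s) '' (V : Set (MvPolynomial (Fin s) k)))) =
        (fun J => J + Finsupp.single (Fin.castLE hs 0) m) '' firstExponents s r n) :
    ∃ (D D' : Derivation k (MvPolynomial (Fin 3) (GenericField k s))
        (MvPolynomial (Fin 3) (GenericField k s))) (p : MvPolynomial (Fin 3) (GenericField k s)),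
      IsFlagStable (Submodule.span (GenericField k s) (planeRestriction k hs '' V)) n m D D' p := by
  obtain ⟨D, hDC, hDX, hD⟩ := exists_derivation_planeRestriction (k := k) hs 1 2
  obtain ⟨D', hDC', hDX', hD'⟩ := exists_derivation_planeRestriction (k := k) hs 0 1
  have hinj := Fin.castLE_injective hs
  have hlead : ∀ N g, X 2 ^ N * g ∈ Submodule.span (GenericField k s)
      (planeRestriction k hs '' (V : Set (MvPolynomial (Fin s) k))) →
      restrictLine _ g ≠ 0 → N ≤ n ∧ m ≤ (restrictLine _ g).natDegree := by
    intro N g hmem hg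
    obtain ⟨I, hI, hI0, hI2, hmax⟩ :=
      exists_leading_exponent (span_planeRestriction_isHomogeneous hV hmem) hg
    rw [span_planeRestriction] at hmem
    obtain ⟨F, hF, hFg⟩ := hmem
    change killCompl hinj F = _ at hFg
    rw [← hFg] at hI hmax
    have hin := isInitialExponent_of_killCompl hs hI hmax
    have : I.mapDomain (Fin.castLE hs) ∈ initialExponents (Submodule.span (GenericField k s)
      (linearSubst (genericMatrix k s) '' (V : Set (MvPolynomial (Fin s) k)))) :=
      ⟨F, hF, ⟨_, span_linearSubst_isHomogeneous hV hF⟩, hin⟩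
    rw [hE] at this
    obtain ⟨J, ⟨hJ, -⟩, hJI⟩ := this
    -- The initial exponent is J plus m at the first variable, with J of degree n: its first entry
    -- is at least m and its third at most n.
    have h0 := DFunLike.congr_fun hJI (Fin.castLE hs 0)
    have h2 := DFunLike.congr_fun hJI (Fin.castLE hs 2)
    simp only [Finsupp.add_apply] at h0 h2
    rw [Finsupp.mapDomain_apply hinj, Finsupp.single_eq_same, hI0] at h0
    rw [Finsupp.mapDomain_apply hinj, Finsupp.single_apply, if_neg (by
      intro h; exact absurd (hinj h) (by decide)), hI2, add_zero] at h2
    have hle := Finsupp.le_degree (Fin.castLE hs 2) J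
    omega
  obtain ⟨p, hp, hpmem, hpdeg, hpne⟩ : ∃ p : MvPolynomial (Fin 3) (GenericField k s),
      p.IsHomogeneous m ∧ X 2 ^ n * p ∈ Submodule.span (GenericField k s)
        (planeRestriction k hs '' (V : Set (MvPolynomial (Fin s) k))) ∧
      (restrictLine _ p).natDegree = m ∧ restrictLine _ p ≠ 0 := by
    let J₀ : Fin 3 →₀ ℕ := Finsupp.single 2 n
    let I₀ : Fin 3 →₀ ℕ := Finsupp.single 2 n + Finsupp.single 0 m
    have hmem : I₀.mapDomain (Fin.castLE hs) ∈ initialExponents (Submodule.span (GenericField k s)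
        (linearSubst (genericMatrix k s) '' (V : Set (MvPolynomial (Fin s) k)))) := by
      rw [hE]
      refine ⟨J₀.mapDomain (Fin.castLE hs), ⟨?_, ?_⟩, ?_⟩
      · simp [J₀, Finsupp.mapDomain_single]
      · intro i hi
        simp only [J₀, Finsupp.mapDomain_single]
        rw [Finsupp.single_apply, if_neg]
        rintro rfl
        simp at hi
        omega
      · simp [J₀, I₀, Finsupp.mapDomain_add, Finsupp.mapDomain_single]
    obtain ⟨F, hF, -, hFI, hFmax⟩ := hmem
    set f := killCompl hinj F with hf
    have hfmem : f ∈ Submodule.span (GenericField k s)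
        (planeRestriction k hs '' (V : Set (MvPolynomial (Fin s) k))) := by
      rw [span_planeRestriction]
      exact ⟨F, hF, rfl⟩
    have hfhom := span_planeRestriction_isHomogeneous hV hfmem
    have hfI : coeff I₀ f ≠ 0 := by
      rw [hf, coeff_killCompl]
      exact mem_support_iff.mp hFI
    -- A monomial of f with fewer factors `X₂` would exceed the initial monomial.
    have hdvd : X 2 ^ n ∣ f := by
      rw [X_pow_eq_monomial, monomial_one_dvd_iff_modMonomial_eq_zero]
      ext J
      rw [coeff_zero]
      by_cases hJ : Finsupp.single 2 n ≤ J
      · exact coeff_modMonomial_of_le _ hJ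
      rw [coeff_modMonomial_of_not_le _ hJ]
      by_contra hne
      have hJ2 : J 2 < n := by
        rw [Finsupp.single_le_iff] at hJ
        omega
      have hJsupp : J.mapDomain (Fin.castLE hs) ∈ F.support := by
        rw [mem_support_iff, ← coeff_killCompl hinj]
        exact hne
      obtain ⟨t, ht, ht'⟩ := hFmax _ hJsupp (by
        intro h
        have := Finsupp.mapDomain_injective hinj h
        rw [this] at hJ2
        simp [I₀] at hJ2)
      have hI2 : I₀.mapDomain (Fin.castLE hs) (Fin.castLE hs 2) = n := by
        rw [Finsupp.mapDomain_apply hinj]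
        simp [I₀]
      have hJ2' : J.mapDomain (Fin.castLE hs) (Fin.castLE hs 2) = J 2 :=
        Finsupp.mapDomain_apply hinj J 2
      rcases lt_trichotomy t (Fin.castLE hs 2) with htlt | rfl | htlt
      · have := ht' _ htlt
        omega
      · omega
      · rw [Finsupp.mapDomain_of_notMem_range (x := J)] at ht
        · omega
        · rintro ⟨i, rfl⟩
          have h1 : (2 : ℕ) < i := htlt
          have := i.2
          omega
    obtain ⟨p, hp⟩ := hdvd
    rw [hp] at hfhom hfmem hfI
    have hp0 : p ≠ 0 := by
      rintro rfl
      rw [mul_zero, coeff_zero] at hfI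
      exact hfI rfl
    rw [coeff_X_pow_mul_add] at hfI
    obtain ⟨e, he, hpe⟩ := MvPolynomial.IsHomogeneous.of_mul_left (isHomogeneous_X_pow 2 n)
      (pow_ne_zero _ (X_ne_zero _)) hfhom hp0
    obtain rfl : e = m := by omega
    rw [← coeff_restrictLine hpe (by simp) (by simp), Finsupp.single_eq_same] at hfI
    refine ⟨p, hpe, hfmem, ?_, ?_⟩
    · exact le_antisymm (natDegree_restrictLine_le hpe) (Polynomial.le_natDegree_of_ne_zero hfI)
    · intro h
      rw [h, Polynomial.coeff_zero] at hfI
      exact hfI rfl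
  refine ⟨D, D', p, ?_⟩
  exact
    { homogeneous := fun f hf => span_planeRestriction_isHomogeneous hV hf
      stable := fun f hf => derivation_mem_span_planeRestriction hDC hD hf
      stable' := fun f hf => derivation_mem_span_planeRestriction hDC' hD' hf
      map_X1 := by simpa using hDX 1
      map_X2 := by simpa using hDX 2
      map_X0' := by simpa using hDX' 0
      map_X1' := by simpa using hDX' 1
      map_X2' := by simpa using hDX' 2
      lead := hlead
      homogeneous_p := hp
      mem_p := hpmem
      natDegree_p := hpdeg
      p_ne := hpne }

end PlaneStable

/-! ### Relative primality under extensions of rings -/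

section RelPrime

theorem isUnit_algebraMap_or_exists_prime_dvd {B L : Type*} [CommRing B] [IsDomain B]
    [UniqueFactorizationMonoid B] [CommRing L] [Algebra B L] {u : B} (hu : u ≠ 0) :
    IsUnit (algebraMap B L u) ∨ ∃ π, Prime π ∧ π ∣ u ∧ ¬ IsUnit (algebraMap B L π) := by
  induction u using UniqueFactorizationMonoid.induction_on_prime with
  | h₁ => exact absurd rfl hu
  | h₂ x hx => exact Or.inl (hx.map _)
  | h₃ a π ha hπ ih =>
    by_cases h : IsUnit (algebraMap B L π)
    · rcases ih ha with h' | ⟨ρ, hρ, hρa, hρL⟩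
      · left; rw [map_mul]; exact h.mul h'
      · exact Or.inr ⟨ρ, hρ, hρa.mul_left π, hρL⟩
    · exact Or.inr ⟨π, hπ, dvd_mul_right _ _, h⟩

/-- Relative primality in a factorial domain is preserved by localization. -/
theorem IsRelPrime.algebraMap_of_isLocalization {B L : Type*} [CommRing B] [IsDomain B]
    [UniqueFactorizationMonoid B] [CommRing L] [Algebra B L] (M : Submonoid B)
    [IsLocalization M L] (hM : M ≤ nonZeroDivisors B) {a b : B} (ha : a ≠ 0)
    (h : IsRelPrime a b) : IsRelPrime (algebraMap B L a) (algebraMap B L b) := by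
  intro u hua hub
  have hinj := IsLocalization.injective L hM
  obtain ⟨⟨u₀, m⟩, hu₀⟩ := IsLocalization.surj M u
  have hm : IsUnit (algebraMap B L m) := IsLocalization.map_units L m
  have key : ∀ c, u ∣ algebraMap B L c → ∃ m' ∈ M, u₀ ∣ c * m' := by
    rintro c ⟨v, hv⟩
    obtain ⟨⟨v₀, m'⟩, hv₀⟩ := IsLocalization.surj M v
    refine ⟨m * m', M.mul_mem m.2 m'.2, v₀, ?_⟩
    apply hinj
    simp only at hu₀ hv₀
    rw [map_mul, map_mul, map_mul, ← hu₀, ← hv₀, hv]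
    ring
  obtain ⟨m₁, hm₁, h₁⟩ := key a hua
  obtain ⟨m₂, hm₂, h₂⟩ := key b hub
  have hne : ∀ x ∈ M, x ≠ 0 := fun x hx => nonZeroDivisors.ne_zero (hM hx)
  have hu₀0 : u₀ ≠ 0 := by
    rintro rfl
    exact mul_ne_zero ha (hne _ hm₁) (zero_dvd_iff.mp h₁)
  -- A prime that stays a non-unit in L divides no element of M, so denominators can be dropped.
  have hnot : ∀ π : B, Prime π → ¬ IsUnit (algebraMap B L π) → ∀ c x, x ∈ M → π ∣ c * x →
      π ∣ c := by
    intro π hπ hπL c x hx hd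
    refine (hπ.dvd_or_dvd hd).resolve_right fun hd' => hπL ?_
    exact isUnit_of_dvd_unit (map_dvd (algebraMap B L) hd') (IsLocalization.map_units L ⟨x, hx⟩)
  rcases isUnit_algebraMap_or_exists_prime_dvd (L := L) hu₀0 with hunit | ⟨π, hπ, hπu, hπL⟩
  · simp only at hu₀
    rw [← hu₀] at hunit
    exact isUnit_of_mul_isUnit_left hunit
  · exact absurd (h (hnot π hπ hπL a m₁ hm₁ (hπu.trans h₁)) (hnot π hπ hπL b m₂ hm₂ (hπu.trans h₂)))
      hπ.not_isUnit

theorem IsRelPrime.mvPolynomial_C {σ R : Type*} [CommRing R] [IsDomain R] {a b : R} (ha : a ≠ 0)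
    (h : IsRelPrime a b) : IsRelPrime (MvPolynomial.C a : MvPolynomial σ R) (MvPolynomial.C b) := by
  intro u hua hub
  obtain ⟨c, hca, rfl⟩ := (MvPolynomial.dvd_C_iff_exists ha).mp hua
  have hcb : c ∣ b := by
    rw [MvPolynomial.C_dvd_iff_dvd_coeff] at hub
    simpa using hub 0
  exact (h hca hcb).map _

/-- Degrees in each variable add up in a domain, so a divisor involves no new variable. -/
theorem exists_rename_eq_of_dvd {σ τ R : Type*} [CommRing R] [IsDomain R] {e : σ → τ}
    (he : Function.Injective e) {f : MvPolynomial σ R} (hf : f ≠ 0) {u : MvPolynomial τ R}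
    (hu : u ∣ MvPolynomial.rename e f) : ∃ v, MvPolynomial.rename e v = u := by
  classical
  apply MvPolynomial.exists_rename_eq_of_vars_subset_range _ _ he
  intro i hi
  obtain ⟨w, hw⟩ := hu
  have hne : MvPolynomial.rename e f ≠ 0 := fun h =>
    hf (MvPolynomial.rename_injective e he (by rw [h, map_zero]))
  have hu0 : u ≠ 0 := by rintro rfl; exact hne (by rw [hw, zero_mul])
  have hw0 : w ≠ 0 := by rintro rfl; exact hne (by rw [hw, mul_zero])
  have hdeg : (MvPolynomial.rename e f).degreeOf i ≠ 0 := by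
    rw [hw, MvPolynomial.degreeOf_mul_eq hu0 hw0]
    have := MvPolynomial.mem_vars_iff_degreeOf_ne_zero.mp hi
    omega
  have := MvPolynomial.vars_rename e f (MvPolynomial.mem_vars_iff_degreeOf_ne_zero.mpr hdeg)
  obtain ⟨j, -, rfl⟩ := Finset.mem_image.mp this
  exact ⟨j, rfl⟩

theorem isRelPrime_rename {σ τ R : Type*} [CommRing R] [IsDomain R] {e : σ → τ}
    (he : Function.Injective e) {f h : MvPolynomial σ R} (hf : f ≠ 0) (hfh : IsRelPrime f h) :
    IsRelPrime (MvPolynomial.rename e f) (MvPolynomial.rename e h) := by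
  intro u huf huh
  obtain ⟨v, rfl⟩ := exists_rename_eq_of_dvd he hf huf
  have hdvd : ∀ g, MvPolynomial.rename e v ∣ MvPolynomial.rename e g → v ∣ g := by
    intro g hg
    have := map_dvd (MvPolynomial.killCompl (R := R) he) hg
    rwa [MvPolynomial.killCompl_rename_app, MvPolynomial.killCompl_rename_app] at this
  exact (hfh (hdvd f huf) (hdvd h huh)).map _

theorem IsRelPrime.map_of_leftInverse {A B : Type*} [CommRing A] [CommRing B] (φ : A →+* B)
    (ψ : B →+* A) (h₁ : ∀ x, φ (ψ x) = x) (h₂ : ∀ x, ψ (φ x) = x) {a b : A}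
    (h : IsRelPrime a b) : IsRelPrime (φ a) (φ b) := by
  intro u hua hub
  have ha := map_dvd ψ hua
  have hb := map_dvd ψ hub
  rw [h₂] at ha hb
  rw [← h₁ u]
  exact (h ha hb).map φ

end RelPrime

/-! ### Dehomogenization of ternary forms -/

section Dehomogenize

open MvPolynomial

/-- Dehomogenization of ternary forms with respect to the first variable. -/
noncomputable def dehomogenize (K : Type*) [Field K] :
    MvPolynomial (Fin 3) K →ₐ[K] MvPolynomial (Fin 2) K :=
  aeval ![1, X 0, X 1]

variable {K : Type*} [Field K]

theorem dehomogenize_monomial (I : Fin 3 →₀ ℕ) (a : K) :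
    dehomogenize K (monomial I a) = monomial I.tail a := by
  rw [dehomogenize, aeval_monomial, Finsupp.prod_fintype _ _ (by simp), Fin.prod_univ_three,
    monomial_eq, Finsupp.prod_fintype _ _ (by simp), Fin.prod_univ_two]
  simp only [Matrix.cons_val_zero, Matrix.cons_val_one, Matrix.cons_val, one_pow, one_mul]
  rfl

theorem coeff_dehomogenize {f : MvPolynomial (Fin 3) K} {d : ℕ} (hf : f.IsHomogeneous d)
    {I : Fin 3 →₀ ℕ} (hI : I.degree = d) : coeff I.tail (dehomogenize K f) = coeff I f := by
  classical
  conv_lhs => rw [f.as_sum]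
  rw [map_sum, coeff_sum, Finset.sum_eq_single I]
  · rw [dehomogenize_monomial, coeff_monomial, if_pos rfl]
  · intro J hJ hJI
    rw [dehomogenize_monomial, coeff_monomial, if_neg]
    intro h
    apply hJI
    have hJd := degree_eq_of_mem_support hf hJ
    rw [Finsupp.degree_eq_sum, Fin.sum_univ_three] at hJd hI
    have h1 : J 1 = I 1 := DFunLike.congr_fun h 0
    have h2 : J 2 = I 2 := DFunLike.congr_fun h 1
    ext i
    fin_cases i
    · change J 0 = I 0
      omega
    · exact h1
    · exact h2
  · intro h
    rw [dehomogenize_monomial, notMem_support_iff.mp h]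
    simp

theorem eq_of_dehomogenize_eq {f g : MvPolynomial (Fin 3) K} {d : ℕ} (hf : f.IsHomogeneous d)
    (hg : g.IsHomogeneous d) (h : dehomogenize K f = dehomogenize K g) : f = g := by
  ext I
  by_cases hI : I.degree = d
  · rw [← coeff_dehomogenize hf hI, h, coeff_dehomogenize hg hI]
  · rw [hf.coeff_eq_zero hI, hg.coeff_eq_zero hI]

end Dehomogenize

/-! ### Relatively prime forms on a generic plane -/

section Bertini

open MvPolynomial

variable {k : Type*} [Field k] {s : ℕ}

/-- The unipotent substitution `u_{i0} ↦ u_{i0} + c (u_{i1} y₀ + u_{i2} y₁)`. -/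
noncomputable def shear (k : Type*) [Field k] {s : ℕ} (hs : 3 ≤ s)
    (c : MvPolynomial (Fin 2) (MvPolynomial (Fin s × Fin s) k)) :
    MvPolynomial (Fin 2) (MvPolynomial (Fin s × Fin s) k) →+*
      MvPolynomial (Fin 2) (MvPolynomial (Fin s × Fin s) k) :=
  eval₂Hom (aeval (R := k) fun ij : Fin s × Fin s => C (X ij) +
    if ij.2 = Fin.castLE hs 0 then
      c * (C (X (ij.1, Fin.castLE hs 1)) * X 0 + C (X (ij.1, Fin.castLE hs 2)) * X 1)
    else 0).toRingHom X

theorem shear_X (hs : 3 ≤ s) (c) (j : Fin 2) : shear k hs c (X j) = X j := by simp [shear]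

theorem shear_C_X (hs : 3 ≤ s) (c) (ij : Fin s × Fin s) : shear k hs c (C (X ij)) =
    C (X ij) + if ij.2 = Fin.castLE hs 0 then
      c * (C (X (ij.1, Fin.castLE hs 1)) * X 0 + C (X (ij.1, Fin.castLE hs 2)) * X 1)
    else 0 := by
  simp [shear]

theorem shear_C_C (hs : 3 ≤ s) (c) (a : k) : shear k hs c (C (C a)) = C (C a) := by
  simp [shear, MvPolynomial.algebraMap_apply]

/-- Only the `u_{i0}` move, by terms that are themselves fixed, so opposite shears cancel. With c =
±1 this makes the shear an automorphism. -/
theorem shear_shear (hs : 3 ≤ s) (c) (hc : ∀ d, shear k hs d c = c) (x) :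
    shear k hs c (shear k hs (-c) x) = x := by
  have h1 : Fin.castLE hs 1 ≠ Fin.castLE hs 0 := fun h =>
    absurd (Fin.castLE_injective hs h) (by decide)
  have h2 : Fin.castLE hs 2 ≠ Fin.castLE hs 0 := fun h =>
    absurd (Fin.castLE_injective hs h) (by decide)
  have : (shear k hs c).comp (shear k hs (-c)) = RingHom.id _ := by
    apply MvPolynomial.ringHom_ext
    · intro p
      have : ((shear k hs c).comp (shear k hs (-c))).comp C =
          (C : MvPolynomial (Fin s × Fin s) k →+*
            MvPolynomial (Fin 2) (MvPolynomial (Fin s × Fin s) k)) := by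
        apply MvPolynomial.ringHom_ext
        · intro a
          simp only [RingHom.comp_apply, shear_C_C]
        · intro ij
          simp only [RingHom.comp_apply, shear_C_X]
          by_cases hij : ij.2 = Fin.castLE hs 0
          · simp only [if_pos hij, map_add, map_mul, map_neg, shear_C_X, shear_X, hc, if_neg h1,
              if_neg h2]
            ring
          · simp only [if_neg hij, shear_C_X, add_zero]
      exact congrArg (fun φ => φ p) this
    · intro j
      simp only [RingHom.comp_apply, shear_X, RingHom.id_apply]
  exact congrArg (fun φ => φ x) this

/-- In affine coordinates the restriction is `f(u_{i0} + u_{i1} y₀ + u_{i2} y₁)`: a copy of f in the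
variables of column 0, moved by an automorphism. Relative primality on the plane thereby reduces to
that of the original forms. -/
theorem dehomogenize_planeRestriction (hs : 3 ≤ s) (f : MvPolynomial (Fin s) k) :
    dehomogenize _ (planeRestriction k hs f) =
      MvPolynomial.map (algebraMap (MvPolynomial (Fin s × Fin s) k) (GenericField k s))
        (shear k hs 1 (C (rename (fun i => (i, Fin.castLE hs 0)) f))) := by
  have : ((dehomogenize (GenericField k s)).toRingHom.comp (planeRestriction k hs).toRingHom) =
      ((MvPolynomial.map (algebraMap (MvPolynomial (Fin s × Fin s) k) (GenericField k s))).comp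
        (shear k hs 1)).comp
          (C.comp (rename (R := k) fun i => (i, Fin.castLE hs 0)).toRingHom) := by
    apply MvPolynomial.ringHom_ext
    · intro a
      change dehomogenize _ (planeRestriction k hs (C a)) = MvPolynomial.map _ (shear k hs 1
        (C (rename (fun i => (i, Fin.castLE hs 0)) (C a))))
      rw [rename_C, shear_C_C, map_C, algHom_C, MvPolynomial.algebraMap_apply,
        algHom_C, MvPolynomial.algebraMap_eq,
        IsScalarTower.algebraMap_apply k (MvPolynomial (Fin s × Fin s) k),
        MvPolynomial.algebraMap_eq]
    · intro i
      simp only [RingHom.comp_apply, AlgHom.toRingHom_eq_coe, RingHom.coe_coe, rename_X, shear_C_X,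
        planeRestriction, linearSubst_X, Fin.sum_univ_three, map_add, map_mul, map_C]
      simp [dehomogenize, MvPolynomial.algebraMap_eq, genericMatrix, Matrix.mvPolynomialX]
      ring
  exact congrArg (fun φ => φ f) this

/-- At the point (0, 1, 0) the restriction takes the value of f at the column of `U` with index 1,
whose entries are independent variables. -/
theorem eq_zero_of_X0_dvd_planeRestriction (hs : 3 ≤ s) {f : MvPolynomial (Fin s) k}
    (h : X 0 ∣ planeRestriction k hs f) : f = 0 := by
  have hκ : ∀ f, aeval (R := GenericField k s)
      ![0, 1, (0 : GenericField k s)] (planeRestriction k hs f) =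
      algebraMap (MvPolynomial (Fin s × Fin s) k) (GenericField k s)
        (rename (fun i => (i, Fin.castLE hs 1)) f) := by
    intro f
    have : ((aeval (R := GenericField k s) ![0, 1, (0 : GenericField k s)]).restrictScalars
        k).comp (planeRestriction k hs) = (IsScalarTower.toAlgHom k
          (MvPolynomial (Fin s × Fin s) k) (GenericField k s)).comp
            (rename fun i => (i, Fin.castLE hs 1)) := by
      apply MvPolynomial.algHom_ext
      intro i
      simp [planeRestriction, linearSubst_X, Fin.sum_univ_three, genericMatrix,
        Matrix.mvPolynomialX]
    exact congrArg (fun φ => φ f) this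
  have h1 := map_dvd (aeval (R := GenericField k s) ![0, 1, (0 : GenericField k s)]) h
  rw [hκ, aeval_X] at h1
  simp only [Matrix.cons_val_zero, zero_dvd_iff, FaithfulSMul.algebraMap_eq_zero_iff] at h1
  refine rename_injective _ ?_ (h1.trans (map_zero _).symm)
  intro i j hij
  exact (Prod.mk.inj hij).1

theorem planeRestriction_injective (hs : 3 ≤ s) :
    Function.Injective (planeRestriction k hs) := by
  rw [injective_iff_map_eq_zero]
  intro f hf
  exact eq_zero_of_X0_dvd_planeRestriction hs (hf ▸ dvd_zero _)

/-- Relatively prime forms remain relatively prime on the generic plane. -/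
theorem isRelPrime_planeRestriction (hs : 3 ≤ s) {f h : MvPolynomial (Fin s) k} {d : ℕ}
    (hfd : f.IsHomogeneous d) (hf : f ≠ 0) (hfh : IsRelPrime f h) :
    IsRelPrime (planeRestriction k hs f) (planeRestriction k hs h) := by
  set K := GenericField k s
  have hinj : Function.Injective fun i : Fin s => (i, Fin.castLE hs 0) := fun i j hij =>
    (Prod.mk.inj hij).1
  have hrf : rename (fun i => (i, Fin.castLE hs 0)) f ≠ 0 := fun h =>
    hf (rename_injective _ hinj (by rw [h, map_zero]))
  have h1 := (isRelPrime_rename hinj hf hfh).mvPolynomial_C (σ := Fin 2) hrf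
  have h2 := h1.map_of_leftInverse (shear k hs 1) (shear k hs (-1))
    (shear_shear hs 1 fun d => map_one _) (by
      intro x
      have := shear_shear hs (-1) (fun d => by rw [map_neg, map_one]) x
      rwa [neg_neg] at this)
  have hne : shear k hs 1 (C (rename (fun i => (i, Fin.castLE hs 0)) f)) ≠ 0 := by
    intro h0
    apply hf
    apply planeRestriction_injective hs
    have hd := dehomogenize_planeRestriction hs f
    rw [h0, map_zero] at hd
    rw [map_zero]
    exact eq_of_dehomogenize_eq (linearSubst_isHomogeneous _ hfd) (isHomogeneous_zero _ _ _)
      (by rw [map_zero]; exact hd)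
  -- `K[y₀, y₁]` is the localization of `k[u][y₀, y₁]` at the nonzero constants from `k[u]`.
  let _ := MvPolynomial.algebraMvPolynomial (σ := Fin 2) (R := MvPolynomial (Fin s × Fin s) k)
    (S := K)
  have h3 := h2.algebraMap_of_isLocalization (L := MvPolynomial (Fin 2) K)
    ((nonZeroDivisors (MvPolynomial (Fin s × Fin s) k)).map C) (by
      rintro _ ⟨x, hx, rfl⟩
      have hx0 : x ≠ 0 := nonZeroDivisors.ne_zero hx
      rw [mem_nonZeroDivisors_iff_ne_zero]
      simpa using hx0) hne
  intro u huf huh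
  obtain ⟨v, hv⟩ := huf
  have hpf : planeRestriction k hs f ≠ 0 := fun h0 =>
    hf (planeRestriction_injective hs (by rw [h0, map_zero]))
  have hfhom : (planeRestriction k hs f).IsHomogeneous d :=
    linearSubst_isHomogeneous _ hfd
  obtain ⟨e, he⟩ := MvPolynomial.IsHomogeneous.exists_of_mul_ne_zero (hv ▸ hfhom) (hv ▸ hpf)
  have hunit : IsUnit (dehomogenize K u) := by
    apply h3
    · have := map_dvd (dehomogenize K) (Dvd.intro v hv.symm)
      rwa [dehomogenize_planeRestriction] at this
    · have := map_dvd (dehomogenize K) huh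
      rwa [dehomogenize_planeRestriction] at this
  obtain ⟨c, hc, hcu⟩ := MvPolynomial.isUnit_iff_eq_C_of_isReduced.mp hunit
  -- Dehomogenizing can hide only a power of `X₀` in the common factor u, and `X₀` does not divide
  -- the restriction of f.
  have hu : u = C c * X 0 ^ e := by
    refine eq_of_dehomogenize_eq he (isHomogeneous_C_mul_X_pow _ _ _) ?_
    rw [hcu]
    simp [dehomogenize]
  rcases Nat.eq_zero_or_pos e with h0 | h0
  · rw [hu, h0, pow_zero, mul_one]
    exact hc.map C
  · refine absurd (eq_zero_of_X0_dvd_planeRestriction hs (f := f) ?_) hf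
    rw [hv, hu]
    exact ((dvd_pow_self _ h0.ne').mul_left _).mul_right _

end Bertini

/-! ### Common divisors of spaces of polynomials -/

section CommonDivisor

theorem dvd_of_dvd_mul_of_isRelPrime {A : Type*} [CommRing A] [IsDomain A]
    [UniqueFactorizationMonoid A] {a b g p : A} (h : IsRelPrime a b) (ha : p ∣ a * g)
    (hb : p ∣ b * g) : p ∣ g := by
  let _ := UniqueFactorizationMonoid.toGCDMonoid A
  have h1 : p ∣ gcd a b * g := (dvd_gcd ha hb).trans (gcd_mul_right' g a b).dvd
  rwa [(gcd_isUnit_iff_isRelPrime.mpr h).dvd_mul_left] at h1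

/-- In a space of polynomials without common prime factor, every nonzero member has a relatively
prime partner. -/
theorem exists_isRelPrime_of_forall_prime {k A : Type*} [Field k] [Infinite k] [CommRing A]
    [IsDomain A] [UniqueFactorizationMonoid A] [Algebra k A] {V : Submodule k A}
    (hV : ∀ π, Prime π → ∃ w ∈ V, ¬ π ∣ w) {f : A} (hf : f ≠ 0) : ∃ h ∈ V, IsRelPrime f h := by
  classical
  let W : A → Subspace k V := fun π =>
    ((Ideal.span {π}).restrictScalars k).comap V.subtype
  have hW : ∀ π (w : V), w ∈ W π ↔ π ∣ (w : A) := by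
    intro π w
    simp only [W, Submodule.mem_comap, Submodule.restrictScalars_mem, Submodule.subtype_apply,
      Ideal.mem_span_singleton]
  -- Each of the finitely many prime factors of f cuts out a proper subspace of V, and over an
  -- infinite field these do not cover V.
  have hne := Subspace.biUnion_ne_univ_of_top_notMem
    (s := (UniqueFactorizationMonoid.factors f).toFinset.image W) (by
      intro htop
      obtain ⟨π, hπ, hπtop⟩ := Finset.mem_image.mp htop
      obtain ⟨w, hw, hπw⟩ := hV π (UniqueFactorizationMonoid.prime_of_factor π
        (Multiset.mem_toFinset.mp hπ))
      exact hπw ((hW π ⟨w, hw⟩).mp (hπtop ▸ Submodule.mem_top)))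
  obtain ⟨h, hh⟩ := (Set.ne_univ_iff_exists_notMem _).mp hne
  refine ⟨h, h.2, ?_⟩
  intro u huf huh
  by_contra hu
  have hu0 : u ≠ 0 := by rintro rfl; exact hf (zero_dvd_iff.mp huf)
  obtain ⟨π', hπ', hπu⟩ := WfDvdMonoid.exists_irreducible_factor hu hu0
  obtain ⟨π, hπ, hass⟩ :=
    UniqueFactorizationMonoid.exists_mem_factors_of_dvd hf hπ' (hπu.trans huf)
  apply hh
  simp only [Finset.mem_image, Multiset.mem_toFinset, Set.mem_iUnion]
  exact ⟨W π, ⟨π, hπ, rfl⟩, (hW π h).mpr (hass.symm.dvd.trans (hπu.trans huh))⟩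

/-- A nonzero space of polynomials has a common divisor whose cofactors have no common prime
factor. -/
theorem exists_common_divisor {k σ : Type*} [Field k] {V : Submodule k (MvPolynomial σ k)}
    (hV : V ≠ ⊥) : ∃ g, g ≠ 0 ∧ (∀ v ∈ V, g ∣ v) ∧
      ∀ π, Prime π → ∃ w ∈ V.comap (LinearMap.mulRight k g), ¬ π ∣ w := by
  obtain ⟨f, hf, hf0⟩ := V.ne_bot_iff.mp hV
  let T : Set ℕ := {d | ∃ g : MvPolynomial σ k, (∀ v ∈ V, g ∣ v) ∧ g.totalDegree = d}
  have hT : BddAbove T := by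
    refine ⟨f.totalDegree, ?_⟩
    rintro _ ⟨g, hg, rfl⟩
    exact MvPolynomial.totalDegree_le_of_dvd_of_isDomain (hg f hf) hf0
  obtain ⟨g, hg, hgT⟩ := Nat.sSup_mem (s := T) ⟨_, 1, fun v _ => one_dvd v, rfl⟩ hT
  have hg0 : g ≠ 0 := by rintro rfl; exact hf0 (zero_dvd_iff.mp (hg f hf))
  refine ⟨g, hg0, hg, fun π hπ => ?_⟩
  -- If π divided all cofactors, π g would be a common divisor; maximality of deg g makes π
  -- constant, hence a unit.
  by_contra! hall
  have hmem : (π * g).totalDegree ∈ T := by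
    refine ⟨π * g, fun v hv => ?_, rfl⟩
    obtain ⟨w, rfl⟩ := hg v hv
    obtain ⟨w', hw'⟩ := hall w (by
      rw [Submodule.mem_comap, LinearMap.mulRight_apply, mul_comm]; exact hv)
    exact ⟨w', by rw [hw']; ring⟩
  have hle := le_csSup hT hmem
  rw [← hgT, MvPolynomial.totalDegree_mul_of_isDomain hπ.ne_zero hg0] at hle
  have hπ0 : π.totalDegree = 0 := by omega
  rw [MvPolynomial.totalDegree_eq_zero_iff_eq_C] at hπ0
  apply hπ.not_isUnit
  have hc : MvPolynomial.coeff 0 π ≠ 0 := by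
    intro h
    rw [h, map_zero] at hπ0
    exact hπ.ne_zero hπ0
  rw [hπ0]
  exact (IsUnit.mk0 _ hc).map MvPolynomial.C

end CommonDivisor

/-! ### Dimension and initial monomials -/

section Dimension

theorem revLexLT_trans {s : ℕ} {I J L : Fin s →₀ ℕ} (h₁ : RevLexLT I J) (h₂ : RevLexLT J L) :
    RevLexLT I L := by
  obtain ⟨t, ht, ht'⟩ := h₁
  obtain ⟨u, hu, hu'⟩ := h₂
  rcases lt_trichotomy t u with h | rfl | h
  · exact ⟨u, by rw [← ht' u h]; exact hu, fun j hj => (hu' j hj).trans (ht' j (h.trans hj))⟩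
  · exact ⟨t, hu.trans ht, fun j hj => (hu' j hj).trans (ht' j hj)⟩
  · exact ⟨t, by rw [hu' t h]; exact ht, fun j hj => (hu' j (h.trans hj)).trans (ht' j hj)⟩

theorem not_revLexLT_self {s : ℕ} (I : Fin s →₀ ℕ) : ¬ RevLexLT I I := by
  rintro ⟨t, ht, -⟩
  exact lt_irrefl _ ht

/-- Polynomials with distinct initial monomials are linearly independent. -/
theorem linearIndependent_of_isInitialExponent {s : ℕ} {K ι : Type*} [Field K] [Finite ι]
    {e : ι → Fin s →₀ ℕ} (he : Function.Injective e) {f : ι → MvPolynomial (Fin s) K}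
    (hf : ∀ i, IsInitialExponent (f i) (e i)) : LinearIndependent K f := by
  classical
  have := Fintype.ofFinite ι
  rw [Fintype.linearIndependent_iff]
  intro c hc
  by_contra! hne
  -- An R-minimal index has the largest initial monomial among those with nonzero coefficient, and
  -- no other term can cancel it.
  let R : ι → ι → Prop := fun i j => RevLexLT (e j) (e i)
  have : IsTrans ι R := ⟨fun i j l h₁ h₂ => revLexLT_trans h₂ h₁⟩
  have : Std.Irrefl R := ⟨fun i => not_revLexLT_self _⟩
  obtain ⟨i, hi, hmin⟩ := (Finite.wellFounded_of_trans_of_irrefl R).has_min {i | c i ≠ 0} hne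
  have h1 := congrArg (MvPolynomial.coeff (e i)) hc
  rw [MvPolynomial.coeff_sum, Finset.sum_eq_single i, MvPolynomial.coeff_smul, smul_eq_mul,
    MvPolynomial.coeff_zero, mul_eq_zero] at h1
  · exact h1.elim hi (MvPolynomial.mem_support_iff.mp (hf i).1)
  · intro j _ hji
    rw [MvPolynomial.coeff_smul, smul_eq_mul]
    by_cases hcj : c j = 0
    · rw [hcj, zero_mul]
    · by_contra hcoeff
      have hmem : e i ∈ (f j).support :=
        MvPolynomial.mem_support_iff.mpr (right_ne_zero_of_mul hcoeff)
      exact hmin j hcj ((hf j).2 _ hmem fun h => hji (he h).symm)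
  · intro h
    exact absurd (Finset.mem_univ i) h

theorem span_image_eq_span_range_basis {k K M N ι : Type*} [Field k] [Field K] [Algebra k K]
    [AddCommGroup M] [Module k M] [AddCommGroup N] [Module k N] [Module K N] [IsScalarTower k K N]
    [Fintype ι] (φ : M →ₗ[k] N) {V : Submodule k M} (b : Module.Basis ι k V) :
    Submodule.span K (φ '' (V : Set M)) = Submodule.span K (Set.range fun i => φ (b i)) := by
  apply le_antisymm
  · rw [Submodule.span_le]
    rintro _ ⟨v, hv, rfl⟩
    have h1 := congrArg (fun x : V => φ x) (b.sum_repr ⟨v, hv⟩)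
    simp only [Submodule.coe_sum, Submodule.coe_smul, map_sum, map_smul] at h1
    rw [SetLike.mem_coe, ← h1]
    refine Submodule.sum_mem _ fun i _ => ?_
    rw [← algebraMap_smul K]
    exact Submodule.smul_mem _ _ (Submodule.subset_span ⟨i, rfl⟩)
  · refine Submodule.span_mono ?_
    rintro _ ⟨i, rfl⟩
    exact ⟨b i, (b i).2, rfl⟩

theorem finiteDimensional_span_image {k K M N : Type*} [Field k] [Field K] [Algebra k K]
    [AddCommGroup M] [Module k M] [AddCommGroup N] [Module k N] [Module K N] [IsScalarTower k K N]
    (φ : M →ₗ[k] N) (V : Submodule k M) [FiniteDimensional k V] :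
    FiniteDimensional K (Submodule.span K (φ '' (V : Set M))) := by
  rw [span_image_eq_span_range_basis φ (Module.finBasis k V)]
  exact FiniteDimensional.span_of_finite K (Set.finite_range _)

theorem finrank_span_image_le {k K M N : Type*} [Field k] [Field K] [Algebra k K]
    [AddCommGroup M] [Module k M] [AddCommGroup N] [Module k N] [Module K N] [IsScalarTower k K N]
    (φ : M →ₗ[k] N) (V : Submodule k M) [FiniteDimensional k V] :
    Module.finrank K (Submodule.span K (φ '' (V : Set M))) ≤ Module.finrank k V := by
  rw [span_image_eq_span_range_basis φ (Module.finBasis k V)]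
  refine (finrank_range_le_card (R := K) _).trans ?_
  simp

theorem homogeneousSubmodule_eq_span (k : Type*) [Field k] (s n : ℕ) :
    MvPolynomial.homogeneousSubmodule (Fin s) k n = Submodule.span k
      ((fun I : Fin s →₀ ℕ => MvPolynomial.monomial I (1 : k)) '' firstExponents s s n) := by
  apply le_antisymm
  · intro f hf
    rw [f.as_sum]
    refine Submodule.sum_mem _ fun I hI => ?_
    rw [← mul_one (f.coeff I), ← smul_eq_mul, ← MvPolynomial.smul_monomial]
    refine Submodule.smul_mem _ _ (Submodule.subset_span ⟨I, ⟨?_, ?_⟩, rfl⟩)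
    · exact degree_eq_of_mem_support hf hI
    · intro i hi
      exact absurd i.2 (by omega)
  · rw [Submodule.span_le]
    rintro _ ⟨I, hI, rfl⟩
    exact MvPolynomial.isHomogeneous_monomial _ hI.1

/-- The dimension of `V` is at least that of its space of generic initial monomials. -/
theorem finrank_homogeneousSubmodule_le {k : Type*} [Field k] {s n m : ℕ} {i₀ : Fin s}
    {V : Submodule k (MvPolynomial (Fin s) k)} [FiniteDimensional k V]
    (hE : (fun J => J + Finsupp.single i₀ m) '' firstExponents s s n ⊆
      initialExponents (Submodule.span (GenericField k s)
        (linearSubst (genericMatrix k s) '' (V : Set (MvPolynomial (Fin s) k))))) :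
    Module.finrank k (MvPolynomial.homogeneousSubmodule (Fin s) k n) ≤ Module.finrank k V := by
  classical
  have hfin : (firstExponents s s n).Finite :=
    (Finsupp.finite_of_degree_eq n).subset fun J hJ => hJ.1
  have := hfin.fintype
  have h1 : ∀ J : firstExponents s s n, ∃ f ∈ Submodule.span (GenericField k s)
      (linearSubst (genericMatrix k s) '' (V : Set (MvPolynomial (Fin s) k))),
      IsInitialExponent f (J.1 + Finsupp.single i₀ m) := by
    intro J
    obtain ⟨f, hf, -, hf'⟩ := hE ⟨J.1, J.2, rfl⟩
    exact ⟨f, hf, hf'⟩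
  choose f hf hfin using h1
  have hli : LinearIndependent (GenericField k s) f :=
    linearIndependent_of_isInitialExponent
      (e := fun J : firstExponents s s n => J.1 + Finsupp.single i₀ m)
      (fun I J h => Subtype.ext (add_right_cancel h)) hfin
  let F : firstExponents s s n → Submodule.span (GenericField k s)
      (linearSubst (genericMatrix k s) '' (V : Set (MvPolynomial (Fin s) k))) :=
    fun J => ⟨f J, hf J⟩
  have hliF : LinearIndependent (GenericField k s) F :=
    LinearIndependent.of_comp (Submodule.subtype _) hli
  have : FiniteDimensional (GenericField k s) (Submodule.span (GenericField k s)
      (linearSubst (genericMatrix k s) '' (V : Set (MvPolynomial (Fin s) k)))) :=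
    finiteDimensional_span_image (linearSubst (genericMatrix k s)).toLinearMap V
  calc _ ≤ Fintype.card (firstExponents s s n) := by
        rw [homogeneousSubmodule_eq_span, Set.image_eq_range]
        exact finrank_range_le_card _
    _ ≤ _ := hliF.fintype_card_le_finrank
    _ ≤ _ := finrank_span_image_le (linearSubst (genericMatrix k s)).toLinearMap V

end Dimension

/-! ### Descent from the generic plane and the main theorem -/

theorem mainTheorem1 (k : Type*) [Field k] [CharZero k] (s r n m : ℕ) (hr : 3 ≤ r) (hrs : r ≤ s)
    (V : Submodule k (MvPolynomial (Fin s) k))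
    (hV : V ≤ MvPolynomial.homogeneousSubmodule (Fin s) k (n + m))
    (hgin : gin V = mulForm (firstVars k s r ^ n)
      (MvPolynomial.X (⟨0, by omega⟩ : Fin s) ^ m)) :
    ∃ p ∈ MvPolynomial.homogeneousSubmodule (Fin s) k m,
      ∃ Wn ≤ MvPolynomial.homogeneousSubmodule (Fin s) k n,
        V = mulForm Wn p ∧
        (s = r → Wn = MvPolynomial.homogeneousSubmodule (Fin s) k n) := by
  have hs : 3 ≤ s := hr.trans hrs
  have hE := initialExponents_of_gin (by omega) V hgin
  have : CharZero (GenericField k s) := charZero_of_injective_algebraMap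
    (algebraMap k (GenericField k s)).injective
  obtain ⟨D, D', p, hp⟩ := isFlagStable_planeRestriction hs hr hV hE
  have hp0 : p ≠ 0 := by
    rintro rfl
    exact hp.p_ne (map_zero _)
  have hVne : V ≠ ⊥ := by
    rintro rfl
    have h1 := hp.mem_p
    have h2 : planeRestriction k hs '' ((⊥ : Submodule k (MvPolynomial (Fin s) k)) : Set _) =
        {0} := by simp
    rw [h2, Submodule.span_zero_singleton, Submodule.mem_bot] at h1
    exact mul_ne_zero (pow_ne_zero _ (MvPolynomial.X_ne_zero _)) hp0 h1
  obtain ⟨g, hg0, hg, hcop⟩ := exists_common_divisor hVne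
  set W := V.comap (LinearMap.mulRight k g) with hW
  have hWmem : ∀ w, w ∈ W ↔ w * g ∈ V := fun w => Iff.rfl
  obtain ⟨v, hv, hv0⟩ := V.ne_bot_iff.mp hVne
  obtain ⟨f, hfv⟩ := hg v hv
  have hf0 : f ≠ 0 := by rintro rfl; exact hv0 (by rw [hfv, mul_zero])
  obtain ⟨d, hgd⟩ := MvPolynomial.IsHomogeneous.exists_of_mul_ne_zero (a := g) (b := f)
    (hfv ▸ hV hv) (hfv ▸ hv0)
  have hWhom : ∀ w ∈ W, w ≠ 0 → ∃ j, d + j = n + m ∧ w.IsHomogeneous j := by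
    intro w hw hw0
    refine MvPolynomial.IsHomogeneous.of_mul_left hgd hg0 ?_ hw0
    rw [mul_comm]
    exact hV ((hWmem w).mp hw)
  have hfW : f ∈ W := by
    rw [hWmem, mul_comm, ← hfv]
    exact hv
  obtain ⟨h, hhW, hfh⟩ := exists_isRelPrime_of_forall_prime hcop hf0
  have hψg0 : planeRestriction k hs g ≠ 0 := fun h0 =>
    hg0 (planeRestriction_injective hs (by rw [h0, map_zero]))
  -- p divides the restrictions of f g and h g, while those of f and h are relatively prime.
  have hpg : p ∣ planeRestriction k hs g := by
    obtain ⟨j, -, hfj⟩ := hWhom f hfW hf0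
    refine dvd_of_dvd_mul_of_isRelPrime (isRelPrime_planeRestriction hs hfj hf0 hfh) ?_ ?_
    · rw [← map_mul]
      exact hp.dvd_of_mem (Submodule.subset_span ⟨_, (hWmem f).mp hfW, rfl⟩)
    · rw [← map_mul]
      exact hp.dvd_of_mem (Submodule.subset_span ⟨_, (hWmem h).mp hhW, rfl⟩)
  have hgp : planeRestriction k hs g ∣ p := by
    have hdvd : ∀ x ∈ Submodule.span (GenericField k s)
        (planeRestriction k hs '' (V : Set (MvPolynomial (Fin s) k))),
        planeRestriction k hs g ∣ x := by
      intro x hx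
      induction hx using Submodule.span_induction with
      | mem x hx =>
        obtain ⟨v, hv, rfl⟩ := hx
        exact map_dvd _ (hg v hv)
      | zero => exact dvd_zero _
      | add x y _ _ hx hy => exact dvd_add hx hy
      | smul a x _ hx =>
        rw [MvPolynomial.smul_eq_C_mul]
        exact hx.mul_left _
    have hrel : IsRelPrime (MvPolynomial.X 2 ^ n : MvPolynomial (Fin 3) (GenericField k s))
        (MvPolynomial.X 1 ^ n) := by
      refine IsRelPrime.pow ?_
      rw [MvPolynomial.X_prime.irreducible.isRelPrime_iff_not_dvd]
      rw [MvPolynomial.X_dvd_X]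
      simp
    refine dvd_of_dvd_mul_of_isRelPrime hrel (hdvd _ hp.mem_p) (hdvd _ ?_)
    have := hp.X1_pow_mul_p_mem n 0 (by omega)
    rwa [pow_zero, one_mul] at this
  -- The restriction of g, of degree d, and p, of degree m, divide each other.
  have hdm : d = m := by
    have hψ : (planeRestriction k hs g).IsHomogeneous d := linearSubst_isHomogeneous _ hgd
    obtain ⟨a, ha⟩ := hpg
    obtain ⟨b, hb⟩ := hgp
    have ha0 : a ≠ 0 := by rintro rfl; exact hψg0 (by rw [ha, mul_zero])
    have hb0 : b ≠ 0 := by rintro rfl; exact hp0 (by rw [hb, mul_zero])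
    obtain ⟨i, hi, -⟩ := MvPolynomial.IsHomogeneous.of_mul_left hp.homogeneous_p hp0
      (ha ▸ hψ) ha0
    obtain ⟨j, hj, -⟩ := MvPolynomial.IsHomogeneous.of_mul_left hψ hψg0
      (hb ▸ hp.homogeneous_p) hb0
    omega
  subst hdm
  have hVW : V = mulForm W g := by
    apply le_antisymm
    · intro v hv
      obtain ⟨w, rfl⟩ := hg v hv
      exact ⟨w, by rw [SetLike.mem_coe, hWmem, mul_comm]; exact hv, mul_comm _ _⟩
    · rintro _ ⟨w, hw, rfl⟩
      exact hw
  have hWle : W ≤ MvPolynomial.homogeneousSubmodule (Fin s) k n := by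
    intro w hw
    by_cases hw0 : w = 0
    · rw [hw0]; exact Submodule.zero_mem _
    · obtain ⟨j, hj, hwj⟩ := hWhom w hw hw0
      obtain rfl : j = n := by omega
      exact hwj
  refine ⟨g, hgd, W, hWle, hVW, fun hsr => ?_⟩
  subst hsr
  have hfd : ∀ i, FiniteDimensional k (MvPolynomial.homogeneousSubmodule (Fin s) k i) := fun i =>
    Module.Finite.iff_fg.mpr (MvPolynomial.homogeneousSubmodule_fg (Fin s) k i)
  have := hfd n
  have := Submodule.finiteDimensional_of_le hWle
  have hfdV : FiniteDimensional k V := by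
    have := hfd (n + d)
    exact Submodule.finiteDimensional_of_le hV
  -- Multiplication by g maps W onto V, so dim S_n ≤ dim V ≤ dim W.
  refine Submodule.eq_of_le_of_finrank_le hWle ?_
  refine (finrank_homogeneousSubmodule_le hE.ge).trans ?_
  conv_lhs => rw [hVW]
  exact Submodule.finrank_map_le _ _
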